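/- Let $X$ be a smooth (Hausdorff, second countable, boundaryless) manifold of dimension $N+1$, and let $Z\subset X$ be a closed embedded hypersurface. A scattering symplectic structure on $(X,Z)$ is a closed nondegenerate $2$-form $\omega$ on the Lie algebroid ${}^{\mathrm{sc}}TX$ whose sections are locally spanned by $x^2\partial_x,\,x\partial_{y_1},\dots,x\partial_{y_N}$, where $(x,y_1,\dots,y_N)$ are coordinates with $Z=\{x=0\}$. Equivalently, $\omega$ is a symplectic form on $X\setminus Z$ whose components in the coframe $dx/x^2,\,dy_1/x,\dots,dy_N/x$ extend smoothly across $\{x=0\}$ to a nondegenerate form. It induces a canonical cooriented contact structure on $Z$: writing $\omega=\alpha_x\wedge\frac{dx}{x^3}+\frac{\beta_x}{x^2}$, the restriction $\alpha_0|_{TZ}$ is a contact form, well defined up to a positive factor. When this cooriented contact structure is $\ker\alpha$, we say that $(Z,\ker\alpha)$ is the singular locus of $(X,Z,\omega)$. On a manifold with boundary the same definitions are made with $Z$ the boundary; this is called a symplectic manifold with scattering boundary. Let $\alpha$ be a contact form on $Z$ such that $(Z,\ker\alpha)$ is the singular locus of a scattering symplectic manifold $(X,Z,\omega)$ with $X$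 non-orientable. Then there exist a smooth double cover $p:\tilde Z\to Z$ ($\tilde Z$ not necessarily connected) and a symplectic manifold with scattering boundary $(\tilde X,\tilde Z,\tilde\omega)$, $\partial\tilde X=\tilde Z$, whose induced cooriented contact structure on $\tilde Z$ is $\ker p^*\alpha$. Moreover $\tilde X$ is the real oriented blow-up $b:\tilde X\to X$ of $X$ along $Z$, that is, $b$ is smooth, it restricts to a diffeomorphism $\tilde X\setminus\tilde Z\to X\setminus Z$, and in suitable coordinates $(x,y)$ around each point of $Z$ it is the polar coordinate map $(r,\theta,y)\mapsto(\theta r,y)$ with $r\ge 0$, $\theta\in\{1,-1\}$. The map $b$ satisfies $b^{-1}(Z)=\tilde Z$, $b|_{\tilde Z}=p$, and $b^*\omega=\tilde\omega$ on $\tilde X\setminus\tilde Z$. -/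

import Mathlib

open Set Manifold
open scoped ContDiff

universe u v

noncomputable section

namespace Scattering

/-! ### Orientability, contact forms -/

/-- A smooth manifold without boundary is orientable if it has a smooth atlas (compatible with the
given smooth structure) all of whose transition maps have positive Jacobian determinant. -/
def IsOrientable (m : ℕ) (M : Type*) [TopologicalSpace M]
    [ChartedSpace (EuclideanSpace ℝ (Fin m)) M] : Prop :=
  ∃ A ⊆ IsManifold.maximalAtlas (𝓡 m) ∞ M, (∀ x : M, ∃ e ∈ A, x ∈ e.source) ∧
    ∀ e ∈ A, ∀ e' ∈ A, ∀ x ∈ e.source ∩ e'.source, 0 < (fderiv ℝ (e' ∘ e.symm) (e x)).det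

/-- A contact form on a manifold without boundary of dimension `N`: a smooth `1`-form `α`, nowhere
zero, such that `dα` is nondegenerate on `ker α` (for `N = 2n - 1` this says that
`α ∧ (dα)^(n-1)` vanishes nowhere). Around every point, `α` is written as `a` in a chart, and
`dα (v, w) = Da(v)(w) - Da(w)(v)`. -/
def IsContactForm (N : ℕ) {Z : Type*} [TopologicalSpace Z]
    [ChartedSpace (EuclideanSpace ℝ (Fin N)) Z]
    (α : ∀ z : Z, TangentSpace (𝓡 N) z →L[ℝ] ℝ) : Prop :=
  ∀ z : Z, ∃ ψ ∈ IsManifold.maximalAtlas (𝓡 N) ∞ Z, z ∈ ψ.source ∧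
    ∃ a : EuclideanSpace ℝ (Fin N) → (EuclideanSpace ℝ (Fin N) →L[ℝ] ℝ),
      ContDiffOn ℝ ∞ a ψ.target ∧
      (∀ z' ∈ ψ.source, ∀ v : TangentSpace (𝓡 N) z',
        α z' v = a (ψ z') (mfderiv (𝓡 N) 𝓘(ℝ, EuclideanSpace ℝ (Fin N)) ψ z' v)) ∧
      ∀ y ∈ ψ.target, a y ≠ 0 ∧
        ∀ v, a y v = 0 → (∀ w, a y w = 0 → fderiv ℝ a y v w - fderiv ℝ a y w v = 0) → v = 0

/-- The pull-back of a `1`-form by a smooth map. -/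
def pullbackOneForm (N : ℕ) {Z' Z : Type*} [TopologicalSpace Z']
    [ChartedSpace (EuclideanSpace ℝ (Fin N)) Z'] [TopologicalSpace Z]
    [ChartedSpace (EuclideanSpace ℝ (Fin N)) Z] (p : Z' → Z)
    (α : ∀ z : Z, TangentSpace (𝓡 N) z →L[ℝ] ℝ) : ∀ z : Z', TangentSpace (𝓡 N) z →L[ℝ] ℝ :=
  fun z => (α (p z)).comp (mfderiv (𝓡 N) (𝓡 N) p z)

/-- Nondegeneracy of an alternating `2`-form on a vector space. -/
def Nondegenerate {E : Type*} [NormedAddCommGroup E] [NormedSpace ℝ E]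
    (θ : E [⋀^Fin 2]→L[ℝ] ℝ) : Prop :=
  ∀ v, (∀ w, θ ![v, w] = 0) → v = 0

/-! ### Coordinates `(x, y)` adapted to a hypersurface -/

/-- The vector `(x, y₁, …, y_N)`. -/
def sliceVec {N : ℕ} (x : ℝ) (y : EuclideanSpace ℝ (Fin N)) : EuclideanSpace ℝ (Fin (N + 1)) :=
  WithLp.toLp 2 (Fin.cons x fun i => y i)

/-- The scattering coframe `(dx / x², dy₁ / x, …, dy_N / x)` at a point whose first coordinate is
`x`, evaluated on `v`: the components of `v` in the scattering frame
`x² ∂_x, x ∂_{y₁}, …, x ∂_{y_N}`. -/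
def scatteringCoframe {N : ℕ} (x : ℝ) (v : EuclideanSpace ℝ (Fin (N + 1))) :
    EuclideanSpace ℝ (Fin (N + 1)) :=
  WithLp.toLp 2 (Fin.cons (v 0 / x ^ 2) fun i => v i.succ / x)

section Form

variable {N : ℕ} {H : Type*} [TopologicalSpace H]
  (I : ModelWithCorners ℝ (EuclideanSpace ℝ (Fin (N + 1))) H)
  {M : Type*} [TopologicalSpace M] [ChartedSpace H M]
  {Z : Type*} [TopologicalSpace Z] [ChartedSpace (EuclideanSpace ℝ (Fin N)) Z]

/-- A chart `φ = (x, y₁, …, y_N)` of `M` adapted to the hypersurface `ι : Z → M`: the part of the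
hypersurface in the domain of `φ` is `{x = 0}`, and `ψ = (y₁, …, y_N)` is a chart of `Z` there.
For the boundary of a manifold with boundary, `φ` is a boundary chart. -/
structure IsSliceChart (ι : Z → M) (φ : OpenPartialHomeomorph M H)
    (ψ : OpenPartialHomeomorph Z (EuclideanSpace ℝ (Fin N))) : Prop where
  mem_atlas : φ ∈ IsManifold.maximalAtlas I ∞ M
  mem_atlas' : ψ ∈ IsManifold.maximalAtlas (𝓡 N) ∞ Z
  source_eq : ψ.source = ι ⁻¹' φ.source
  apply_eq : ∀ z ∈ ψ.source, φ.extend I (ι z) = sliceVec 0 (ψ z)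
  mem_range_iff : ∀ q ∈ φ.source, q ∈ range ι ↔ φ.extend I q 0 = 0

/-- In the adapted chart `(φ, ψ)`, the `2`-form `Ω`, given off the hypersurface, is a
nondegenerate section of the second exterior power of the scattering cotangent bundle: its
components `η` in the scattering coframe `dx / x², dy₁ / x, …, dy_N / x` extend smoothly over
`{x = 0}`, and the extension is nondegenerate at every point, those with `x = 0` included.
(The values of `Ω` as an ordinary form at points of the hypersurface are irrelevant.) -/
structure IsScatteringChart (ι : Z → M) (Ω : ∀ q : M, TangentSpace I q [⋀^Fin 2]→L[ℝ] ℝ)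
    (φ : OpenPartialHomeomorph M H) (ψ : OpenPartialHomeomorph Z (EuclideanSpace ℝ (Fin N)))
    (η : EuclideanSpace ℝ (Fin (N + 1)) → (EuclideanSpace ℝ (Fin (N + 1))) [⋀^Fin 2]→L[ℝ] ℝ) :
    Prop where
  slice : IsSliceChart I ι φ ψ
  smooth : ContDiffOn ℝ ∞ η (φ.extend I).target
  apply_eq : ∀ q ∈ φ.source, q ∉ range ι → ∀ v w : TangentSpace I q,
    Ω q ![v, w] = η (φ.extend I q)
      ![scatteringCoframe (φ.extend I q 0)
          (mfderiv I 𝓘(ℝ, EuclideanSpace ℝ (Fin (N + 1))) (φ.extend I) q v),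
        scatteringCoframe (φ.extend I q 0)
          (mfderiv I 𝓘(ℝ, EuclideanSpace ℝ (Fin (N + 1))) (φ.extend I) q w)]
  nondegenerate : ∀ x ∈ (φ.extend I).target, Nondegenerate (η x)

/-- `Ω` is a scattering symplectic structure on `M` with singular locus the hypersurface
`ι : Z → M`: a smooth closed nondegenerate `2`-form off the hypersurface which extends, across the
hypersurface, to a smooth nondegenerate section of the second exterior power of the scattering
cotangent bundle. (Such a section is determined by its restriction to the complement of the
hypersurface, where the scattering tangent bundle is the tangent bundle, and it is closed for the
Lie algebroid differential iff it is closed there.) -/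
structure IsScatteringSymplectic (ι : Z → M) (Ω : ∀ q : M, TangentSpace I q [⋀^Fin 2]→L[ℝ] ℝ) :
    Prop where
  regular : ∀ q ∉ range ι, ∃ φ ∈ IsManifold.maximalAtlas I ∞ M, q ∈ φ.source ∧
    ∃ θ : EuclideanSpace ℝ (Fin (N + 1)) → (EuclideanSpace ℝ (Fin (N + 1))) [⋀^Fin 2]→L[ℝ] ℝ,
      ContDiffOn ℝ ∞ θ (φ.extend I).target ∧
      (∀ q' ∈ φ.source, ∀ v w : TangentSpace I q',
        Ω q' ![v, w] = θ (φ.extend I q')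
          ![mfderiv I 𝓘(ℝ, EuclideanSpace ℝ (Fin (N + 1))) (φ.extend I) q' v,
            mfderiv I 𝓘(ℝ, EuclideanSpace ℝ (Fin (N + 1))) (φ.extend I) q' w]) ∧
      ∀ x ∈ (φ.extend I).target,
        extDerivWithin θ (φ.extend I).target x = 0 ∧ Nondegenerate (θ x)
  singular : ∀ z : Z, ∃ φ ψ η, IsScatteringChart I ι Ω φ ψ η ∧ z ∈ ψ.source

/-- The cooriented contact structure induced on the hypersurface by the scattering symplectic
structure `Ω` is `ker α`, cooriented by `α`. Writing `Ω = α_x ∧ dx / x³ + β_x / x²` near a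
point of the hypersurface, the induced contact structure is the kernel of the pull-back of `α₀` to
the hypersurface, that is of `v ↦ η (v, e₀)` at `x = 0`, where `η` is `Ω` in the scattering frame
and `e₀` stands for `x² ∂_x`. Up to a positive factor this does not depend on the chart. -/
def InducesContact (ι : Z → M) (Ω : ∀ q : M, TangentSpace I q [⋀^Fin 2]→L[ℝ] ℝ)
    (α : ∀ z : Z, TangentSpace (𝓡 N) z →L[ℝ] ℝ) : Prop :=
  ∀ z : Z, ∃ φ ψ η, IsScatteringChart I ι Ω φ ψ η ∧ z ∈ ψ.source ∧
    ∃ c : ℝ, 0 < c ∧ ∀ v : TangentSpace (𝓡 N) z,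
      α z v = c * η (sliceVec 0 (ψ z))
        ![sliceVec 0 (mfderiv (𝓡 N) 𝓘(ℝ, EuclideanSpace ℝ (Fin N)) ψ z v), sliceVec 1 0]

end Form

/-! ### The real oriented blow-up of a hypersurface -/

/-- Polar coordinates normal to the hypersurface `{x = 0}`: `(r, y) ↦ (θ r, y)`, for `r ≥ 0` and
`θ` in the `0`-sphere `{1, -1}`. -/
def polar {N : ℕ} (θ : ℤˣ) (u : EuclideanHalfSpace (N + 1)) : EuclideanSpace ℝ (Fin (N + 1)) :=
  WithLp.toLp 2 (Fin.cons (((θ : ℤ) : ℝ) * u.1 0) fun i => u.1 i.succ)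

/-- `b : X' → X` is the real oriented blow-up of `X` along the hypersurface `ι : Z → X`: it is a
diffeomorphism over the complement of the hypersurface, and in a chart `(x, y)` of `X` around any
point of the hypersurface it is the polar coordinate map `(r, θ, y) ↦ (θ r, y)`, `r ≥ 0`,
`θ ∈ {1, -1}`; here `c 1` and `c (-1)` are the charts `(r, y)` of `X'` on the two disjoint parts
of the preimage of the domain of `(x, y)`, and they take all values `(r, y)` that are possible.
The exceptional divisor is the part `r = 0`. -/
structure IsRealOrientedBlowUp (N : ℕ)
    {X : Type*} [TopologicalSpace X] [ChartedSpace (EuclideanSpace ℝ (Fin (N + 1))) X]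
    {X' : Type*} [TopologicalSpace X'] [ChartedSpace (EuclideanHalfSpace (N + 1)) X']
    {Z : Type*} [TopologicalSpace Z] [ChartedSpace (EuclideanSpace ℝ (Fin N)) Z]
    (ι : Z → X) (b : X' → X) : Prop where
  smooth : ContMDiff (𝓡∂ (N + 1)) (𝓡 (N + 1)) ∞ b
  bijOn : BijOn b (b ⁻¹' (range ι)ᶜ) (range ι)ᶜ
  localDiffeo : ∀ q ∈ b ⁻¹' (range ι)ᶜ, IsLocalDiffeomorphAt (𝓡∂ (N + 1)) (𝓡 (N + 1)) ∞ b q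
  local_model : ∀ z : Z, ∃ φ ψ, IsSliceChart (𝓡 (N + 1)) ι φ ψ ∧ z ∈ ψ.source ∧
    ∃ c : ℤˣ → OpenPartialHomeomorph X' (EuclideanHalfSpace (N + 1)),
      (∀ θ, c θ ∈ IsManifold.maximalAtlas (𝓡∂ (N + 1)) ∞ X') ∧
      Disjoint (c 1).source (c (-1)).source ∧
      (c 1).source ∪ (c (-1)).source = b ⁻¹' φ.source ∧
      (∀ θ, (c θ).target = polar θ ⁻¹' φ.target) ∧
      ∀ θ, ∀ q ∈ (c θ).source, φ (b q) = polar θ (c θ q)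

/-- A (smooth) double cover. -/
structure IsDoubleCover (N : ℕ) {Z' Z : Type*} [TopologicalSpace Z']
    [ChartedSpace (EuclideanSpace ℝ (Fin N)) Z'] [TopologicalSpace Z]
    [ChartedSpace (EuclideanSpace ℝ (Fin N)) Z] (p : Z' → Z) : Prop where
  covering : IsCoveringMap p
  localDiffeo : IsLocalDiffeomorph (𝓡 N) (𝓡 N) ∞ p
  two_points : ∀ z : Z, (p ⁻¹' {z}).ncard = 2

/-- `(X', Z', Ω')` is a symplectic manifold with scattering boundary that coincides with
`(Z', ker α)` as a cooriented contact manifold: `ι` identifies `Z'` with the boundary of `X'`,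
`Ω'` is a scattering symplectic structure on `X'` with singular locus the boundary, `α` is a
contact form, and the induced cooriented contact structure is `ker α`. -/
structure HasScatteringBoundary (N : ℕ)
    {X' : Type*} [TopologicalSpace X'] [ChartedSpace (EuclideanHalfSpace (N + 1)) X']
    {Z' : Type*} [TopologicalSpace Z'] [ChartedSpace (EuclideanSpace ℝ (Fin N)) Z']
    (ι : Z' → X') (Ω : ∀ q : X', TangentSpace (𝓡∂ (N + 1)) q [⋀^Fin 2]→L[ℝ] ℝ)
    (α : ∀ z : Z', TangentSpace (𝓡 N) z →L[ℝ] ℝ) : Prop where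
  embedding : IsSmoothEmbedding (𝓡 N) (𝓡∂ (N + 1)) ∞ ι
  range_eq : range ι = (𝓡∂ (N + 1)).boundary X'
  symplectic : IsScatteringSymplectic (𝓡∂ (N + 1)) ι Ω
  contact : IsContactForm N α
  induces : InducesContact (𝓡∂ (N + 1)) ι Ω α

end Scattering

end

/-!
The manifold with boundary is the real oriented blow-up `BlowUp` of `X` along the hypersurface: its
points are the points of `X` off the hypersurface, together with the pairs `SideCover` of a point
of the hypersurface and one of its two local sides. Such sides exist since the normal coordinates
`x`, `x'` of two charts whose first coordinate vanishes exactly on the hypersurface agree, near each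
point of it, up to a locally constant sign and a positive factor
(`IsDefiningChart.exists_relSign`, `IsHypersurface.eventually_side_mul_side`). Hence each such chart
`(x, y)` and each sign `θ` give polar coordinates `(|x|, y)` on the side `θ x ≥ 0`, and the
transition maps between these are transition maps of `X` conjugated by reflections. Off the
hypersurface any chart can be translated into `x > 0`, so that polar coordinates cover the whole
blow-up. Forgetting the side is the blow-down map `BlowUp.pt`, which is a diffeomorphism off the
boundary, and on the boundary it is the double cover `SideCover.base`.

The symplectic form is the pull-back by the blow-down map. On the side `x = -r` of the hypersurface
the coframe `dx / x², dyᵢ / x` becomes `-dr / r², -dyᵢ / r`, so all its members change sign and the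
components of a `2`-form do not: `η (x, y)` becomes `η (-r, y)`
(`BlowUp.isScatteringChart_polarChart`). So these components still extend smoothly and
nondegenerately to the boundary, and the induced contact form, which is read off from `η` at
`x = 0`, is the pull-back of the given one on both sides, with the same coorientation.
-/

namespace Scattering

noncomputable section

open Filter Topology

/-! ### Linear algebra of the reflection `x ↦ -x` -/

/-- The linear map `(x, y) ↦ (θ x, y)`, for a sign `θ`. On the half-space `x ≥ 0` it is `polar`. -/
def reflect {N : ℕ} (θ : ℤˣ) :
    EuclideanSpace ℝ (Fin (N + 1)) →L[ℝ] EuclideanSpace ℝ (Fin (N + 1)) :=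
  LinearMap.toContinuousLinearMap
    { toFun := fun v => WithLp.toLp 2 (Fin.cons (((θ : ℤ) : ℝ) * v 0) fun i => v i.succ)
      map_add' := fun v w => by
        ext i
        refine Fin.cases ?_ (fun j => ?_) i <;> simp [mul_add]
      map_smul' := fun c v => by
        ext i
        refine Fin.cases ?_ (fun j => ?_) i <;> simp [mul_left_comm] }

@[simp] theorem reflect_apply_zero {N : ℕ} (θ : ℤˣ) (v : EuclideanSpace ℝ (Fin (N + 1))) :
    reflect θ v 0 = ((θ : ℤ) : ℝ) * v 0 := rfl

@[simp] theorem reflect_apply_succ {N : ℕ} (θ : ℤˣ) (v : EuclideanSpace ℝ (Fin (N + 1)))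
    (i : Fin N) : reflect θ v i.succ = v i.succ := rfl

theorem intUnit_mul_self (θ : ℤˣ) : ((θ : ℤ) : ℝ) * ((θ : ℤ) : ℝ) = 1 := by
  rcases Int.units_eq_one_or θ with rfl | rfl <;> norm_num

@[simp] theorem reflect_reflect {N : ℕ} (θ : ℤˣ) (v : EuclideanSpace ℝ (Fin (N + 1))) :
    reflect θ (reflect θ v) = v := by
  ext i
  refine Fin.cases ?_ (fun j => ?_) i
  · simp [← mul_assoc, intUnit_mul_self]
  · simp

@[simp] theorem reflect_one {N : ℕ} (v : EuclideanSpace ℝ (Fin (N + 1))) : reflect 1 v = v := by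
  ext i
  refine Fin.cases ?_ (fun j => ?_) i <;> simp

theorem polar_eq_reflect {N : ℕ} (θ : ℤˣ) (u : EuclideanHalfSpace (N + 1)) :
    polar θ u = reflect θ u.1 := rfl

theorem continuous_polar {N : ℕ} (θ : ℤˣ) : Continuous (polar (N := N) θ) :=
  (reflect θ).continuous.comp continuous_subtype_val

/-- The projection `(x, y) ↦ y`. -/
def tail {N : ℕ} : EuclideanSpace ℝ (Fin (N + 1)) →L[ℝ] EuclideanSpace ℝ (Fin N) :=
  LinearMap.toContinuousLinearMap
    { toFun := fun v => WithLp.toLp 2 fun i => v i.succ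
      map_add' := fun v w => by ext i; simp
      map_smul' := fun c v => by ext i; simp }

@[simp] theorem tail_apply {N : ℕ} (v : EuclideanSpace ℝ (Fin (N + 1))) (i : Fin N) :
    tail v i = v i.succ := rfl

@[simp] theorem sliceVec_zero_apply {N : ℕ} (x : ℝ) (y : EuclideanSpace ℝ (Fin N)) :
    sliceVec x y 0 = x := rfl

@[simp] theorem sliceVec_succ_apply {N : ℕ} (x : ℝ) (y : EuclideanSpace ℝ (Fin N)) (i : Fin N) :
    sliceVec x y i.succ = y i := rfl

theorem sliceVec_tail {N : ℕ} (v : EuclideanSpace ℝ (Fin (N + 1))) :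
    sliceVec (v 0) (tail v) = v := by
  ext i
  refine Fin.cases ?_ (fun j => ?_) i <;> simp

@[simp] theorem reflect_sliceVec_zero {N : ℕ} (θ : ℤˣ) (y : EuclideanSpace ℝ (Fin N)) :
    reflect θ (sliceVec 0 y) = sliceVec 0 y := by
  ext i
  refine Fin.cases ?_ (fun j => ?_) i <;> simp

/-- The linear isomorphism `(y, x) ↦ (x, y)`. -/
def sliceEquiv {N : ℕ} :
    (EuclideanSpace ℝ (Fin N) × ℝ) ≃L[ℝ] EuclideanSpace ℝ (Fin (N + 1)) :=
  LinearEquiv.toContinuousLinearEquiv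
    { toFun := fun p => sliceVec p.2 p.1
      invFun := fun v => (tail v, v 0)
      left_inv := fun p => rfl
      right_inv := fun v => sliceVec_tail v
      map_add' := fun p q => by
        ext i
        refine Fin.cases ?_ (fun j => ?_) i <;> simp
      map_smul' := fun c p => by
        ext i
        refine Fin.cases ?_ (fun j => ?_) i <;> simp }

theorem continuous_sliceVec {N : ℕ} (x : ℝ) : Continuous (sliceVec (N := N) x) :=
  sliceEquiv.continuous.comp (by fun_prop : Continuous fun y => (y, x))

/-- Reflecting the normal coordinate multiplies the whole scattering coframe by the sign: all its
members `dx / x²`, `dyᵢ / x` are odd. Hence `2`-forms have the same components on both sides. -/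
theorem scatteringCoframe_reflect {N : ℕ} (θ : ℤˣ) (x : ℝ)
    (v : EuclideanSpace ℝ (Fin (N + 1))) :
    scatteringCoframe (((θ : ℤ) : ℝ) * x) (reflect θ v) =
      ((θ : ℤ) : ℝ) • scatteringCoframe x v := by
  ext i
  refine Fin.cases ?_ (fun j => ?_) i <;> rcases Int.units_eq_one_or θ with rfl | rfl <;>
    simp [scatteringCoframe, neg_div, div_neg]

theorem alternating_intUnit_smul {E : Type*} [NormedAddCommGroup E] [NormedSpace ℝ E]
    (η : E [⋀^Fin 2]→L[ℝ] ℝ) (θ : ℤˣ) (v w : E) :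
    η ![((θ : ℤ) : ℝ) • v, ((θ : ℤ) : ℝ) • w] = η ![v, w] := by
  have h : ![((θ : ℤ) : ℝ) • v, ((θ : ℤ) : ℝ) • w] =
      fun i => ((θ : ℤ) : ℝ) • (![v, w] : Fin 2 → E) i := by
    ext i; fin_cases i <;> rfl
  rw [h, η.map_smul_univ]
  simp [pow_two, intUnit_mul_self]

theorem alternating_scatteringCoframe_reflect {N : ℕ}
    (η : EuclideanSpace ℝ (Fin (N + 1)) [⋀^Fin 2]→L[ℝ] ℝ) (θ : ℤˣ) (x : ℝ)
    (v w : EuclideanSpace ℝ (Fin (N + 1))) :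
    η ![scatteringCoframe (((θ : ℤ) : ℝ) * x) (reflect θ v),
        scatteringCoframe (((θ : ℤ) : ℝ) * x) (reflect θ w)] =
      η ![scatteringCoframe x v, scatteringCoframe x w] := by
  rw [scatteringCoframe_reflect, scatteringCoframe_reflect, alternating_intUnit_smul]

theorem intUnit_eq_of_pos {ε ε' : ℤˣ} {t : ℝ} (h : 0 < ((ε : ℤ) : ℝ) * t)
    (h' : 0 < ((ε' : ℤ) : ℝ) * t) : ε = ε' := by
  rcases Int.units_eq_one_or ε with rfl | rfl <;> rcases Int.units_eq_one_or ε' with rfl | rfl <;>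
    simp at h h' ⊢ <;> linarith

/-! ### Defining charts of a hypersurface and their sides -/

theorem map_normalCoord_nhds {N : ℕ} {X : Type*} [TopologicalSpace X]
    {φ : OpenPartialHomeomorph X (EuclideanSpace ℝ (Fin (N + 1)))} {q : X} (hq : q ∈ φ.source) :
    map (fun q' => φ q' 0) (𝓝 q) = 𝓝 (φ q 0) := by
  have h : (fun q' => φ q' 0) = (fun v : EuclideanSpace ℝ (Fin (N + 1)) => v 0) ∘ φ := rfl
  rw [h, ← Filter.map_map, φ.map_nhds_eq hq]
  exact (PiLp.isOpenMap_apply 2 (fun _ : Fin (N + 1) => ℝ) 0).map_nhds_eq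
    (by fun_prop : Continuous fun v : EuclideanSpace ℝ (Fin (N + 1)) => v 0).continuousAt

theorem frequently_intUnit_mul_normalCoord_pos {N : ℕ} {X : Type*} [TopologicalSpace X]
    {φ : OpenPartialHomeomorph X (EuclideanSpace ℝ (Fin (N + 1)))} {q : X} (hq : q ∈ φ.source)
    (h0 : φ q 0 = 0) (ε : ℤˣ) :
    ∃ᶠ q' in 𝓝 q, 0 < ((ε : ℤ) : ℝ) * φ q' 0 := by
  have h : ∃ᶠ t in 𝓝 (0 : ℝ), 0 < ((ε : ℤ) : ℝ) * t := by
    rw [Metric.nhds_basis_ball.frequently_iff]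
    intro r hr
    refine ⟨((ε : ℤ) : ℝ) * (r / 2), ?_, ?_⟩
    · rcases Int.units_eq_one_or ε with rfl | rfl <;>
        simp [abs_of_pos hr, hr]
    · rw [← mul_assoc, intUnit_mul_self]; linarith
  have hmap := map_normalCoord_nhds hq
  rw [h0] at hmap
  rw [← hmap] at h
  exact Filter.frequently_map.1 h

/-- A continuous function on a convex set on which it vanishes nowhere has a constant sign. -/
theorem exists_intUnit_mul_pos {E : Type*} [NormedAddCommGroup E] [NormedSpace ℝ E] {s : Set E}
    (hs : Convex ℝ s) {f : E → ℝ} (hf : ContinuousOn f s) (h0 : ∀ x ∈ s, f x ≠ 0) :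
    ∃ ε : ℤˣ, ∀ x ∈ s, 0 < ((ε : ℤ) : ℝ) * f x := by
  have hI : (f '' s).OrdConnected := (hs.isPreconnected.image f hf).ordConnected
  have h0' : (0 : ℝ) ∉ f '' s := fun ⟨x, hx, h⟩ => h0 x hx h
  by_cases h : ∃ x ∈ s, 0 < f x
  · obtain ⟨x, hx, hpos⟩ := h
    refine ⟨1, fun y hy => ?_⟩
    simp only [Units.val_one, Int.cast_one, one_mul]
    by_contra! hle
    exact h0' (hI.out (mem_image_of_mem f hy) (mem_image_of_mem f hx) ⟨hle, hpos.le⟩)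
  · push Not at h
    refine ⟨-1, fun y hy => ?_⟩
    have := lt_of_le_of_ne (h y hy) (h0 y hy)
    simp [this]

section Charts

variable {N : ℕ} {X : Type u} [TopologicalSpace X]
  [ChartedSpace (EuclideanSpace ℝ (Fin (N + 1))) X]
  {Z : Type v}

/-- A chart of `X` whose first coordinate vanishes exactly on the hypersurface `ι`; its domain may
be disjoint from the hypersurface. -/
structure IsDefiningChart (ι : Z → X)
    (φ : OpenPartialHomeomorph X (EuclideanSpace ℝ (Fin (N + 1)))) : Prop where
  mem_atlas : φ ∈ IsManifold.maximalAtlas (𝓡 (N + 1)) ∞ X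
  mem_range_iff : ∀ q ∈ φ.source, q ∈ range ι ↔ φ q 0 = 0

theorem IsSliceChart.isDefiningChart [TopologicalSpace Z]
    [ChartedSpace (EuclideanSpace ℝ (Fin N)) Z] {ι : Z → X}
    {φ : OpenPartialHomeomorph X (EuclideanSpace ℝ (Fin (N + 1)))}
    {ψ : OpenPartialHomeomorph Z (EuclideanSpace ℝ (Fin N))}
    (h : IsSliceChart (𝓡 (N + 1)) ι φ ψ) : IsDefiningChart ι φ :=
  ⟨h.mem_atlas, fun q hq => h.mem_range_iff q hq⟩

variable {ι : Z → X} {φ φ' : OpenPartialHomeomorph X (EuclideanSpace ℝ (Fin (N + 1)))} {q : X}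

/-- The normal coordinates of two defining charts around a point of the hypersurface agree up to a
constant sign and a positive factor. They have constant signs on each half of a ball cut by the
hypersurface, and these are opposite since a coordinate is an open map. -/
theorem IsDefiningChart.exists_relSign (h : IsDefiningChart ι φ) (h' : IsDefiningChart ι φ')
    (hq : q ∈ φ.source) (hq' : q ∈ φ'.source) (hS : q ∈ range ι) :
    ∃ ε : ℤˣ, ∀ᶠ q' in 𝓝 q, q' ∉ range ι → 0 < ((ε : ℤ) : ℝ) * (φ q' 0 * φ' q' 0) := by
  set W := φ.target ∩ φ.symm ⁻¹' φ'.source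
  have hWo : IsOpen W := φ.isOpen_inter_preimage_symm φ'.open_source
  have hpW : φ q ∈ W := ⟨φ.map_source hq, by simpa [φ.left_inv hq] using hq'⟩
  obtain ⟨r, hr, hB⟩ := Metric.isOpen_iff.1 hWo _ hpW
  set f : EuclideanSpace ℝ (Fin (N + 1)) → ℝ := fun x => φ' (φ.symm x) 0 with hf
  have hfc : ContinuousOn f W := by
    have h1 : ContinuousOn (fun x => φ' (φ.symm x)) W :=
      φ'.continuousOn.comp (φ.symm.continuousOn.mono inter_subset_left) inter_subset_right
    exact (by fun_prop : Continuous fun v : EuclideanSpace ℝ (Fin (N + 1)) => v 0).comp_continuousOn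
      h1
  have hf0 : ∀ x ∈ W, f x = 0 ↔ x 0 = 0 := fun x hx => by
    rw [hf, ← h'.mem_range_iff _ hx.2, h.mem_range_iff _ (φ.map_target hx.1), φ.right_inv hx.1]
  -- On the half `θ x > 0` of a small ball, the other normal coordinate has a constant sign.
  have key : ∀ θ : ℤˣ, ∃ ε : ℤˣ, ∀ x ∈ Metric.ball (φ q) r,
      0 < ((θ : ℤ) : ℝ) * x 0 → 0 < ((ε : ℤ) : ℝ) * f x := by
    intro θ
    have hc : Convex ℝ (Metric.ball (φ q) r ∩ {x | 0 < ((θ : ℤ) : ℝ) * x 0}) := by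
      refine (convex_ball _ _).inter ?_
      have : IsLinearMap ℝ fun x : EuclideanSpace ℝ (Fin (N + 1)) => ((θ : ℤ) : ℝ) * x 0 :=
        ⟨fun x y => by simp [mul_add], fun c x => by simp [mul_left_comm]⟩
      exact convex_halfSpace_gt this 0
    obtain ⟨ε, hε⟩ := exists_intUnit_mul_pos hc
      (hfc.mono (inter_subset_left.trans hB)) (fun x hx => by
        rw [Ne, hf0 x (hB hx.1)]
        intro h0
        have := hx.2
        simp [h0] at this)
    exact ⟨ε, fun x hx hpos => hε x ⟨hx, hpos⟩⟩
  obtain ⟨ε, hε⟩ := key 1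
  obtain ⟨ε', hε'⟩ := key (-1)
  have hnear : ∀ᶠ q' in 𝓝 q, q' ∈ φ.source ∧ φ q' ∈ Metric.ball (φ q) r :=
    Filter.Eventually.and (φ.open_source.mem_nhds hq)
      ((φ.continuousAt hq).preimage_mem_nhds (Metric.ball_mem_nhds _ hr))
  have hfφ : ∀ q' ∈ φ.source, f (φ q') = φ' q' 0 := fun q' h1 => by simp [hf, φ.left_inv h1]
  -- If both halves had the same sign, the normal coordinate of `φ'` would be `≥ 0` or `≤ 0` near
  -- `q`, although it takes all values near `0` there.
  have hopp : ε' = -ε := by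
    by_contra hne
    have heq : ε' = ε := by
      rcases Int.units_eq_one_or ε with rfl | rfl <;>
        rcases Int.units_eq_one_or ε' with rfl | rfl <;> simp_all
    subst heq
    have h0' : φ' q 0 = 0 := (h'.mem_range_iff q hq').1 hS
    obtain ⟨q', hneg, h1, h2⟩ :=
      ((frequently_intUnit_mul_normalCoord_pos hq' h0' (-ε')).and_eventually hnear).exists
    have hx0 : φ q' 0 ≠ 0 := by
      rw [Ne, ← hf0 _ (hB h2), hfφ q' h1]
      intro h0
      simp [h0] at hneg
    rw [← hfφ q' h1] at hneg
    simp only [Units.val_neg, Int.cast_neg, neg_mul] at hneg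
    rcases lt_or_gt_of_ne hx0 with hlt | hgt
    · have := hε' _ h2 (by simpa using hlt)
      linarith
    · have := hε _ h2 (by simpa using hgt)
      linarith
  refine ⟨ε, hnear.mono fun q' hq1 hqS => ?_⟩
  have hx0 : φ q' 0 ≠ 0 := fun h0 => hqS ((h.mem_range_iff q' hq1.1).2 h0)
  rw [← hfφ q' hq1.1]
  rcases lt_or_gt_of_ne hx0 with hlt | hgt
  · have := hε' _ hq1.2 (by simpa using hlt)
    rw [hopp] at this
    simp only [Units.val_neg, Int.cast_neg, neg_mul] at this
    nlinarith
  · have := hε _ hq1.2 (by simpa using hgt)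
    nlinarith

/-- The sign relating the normal coordinates of two defining charts near a point of the
hypersurface which lies in both domains; elsewhere the value is arbitrary. -/
def relSign (ι : Z → X) (φ φ' : OpenPartialHomeomorph X (EuclideanSpace ℝ (Fin (N + 1))))
    (q : X) : ℤˣ :=
  Classical.epsilon fun ε : ℤˣ =>
    ∀ᶠ q' in 𝓝 q, q' ∉ range ι → 0 < ((ε : ℤ) : ℝ) * (φ q' 0 * φ' q' 0)

theorem IsDefiningChart.relSign_spec (h : IsDefiningChart ι φ) (h' : IsDefiningChart ι φ')
    (hq : q ∈ φ.source) (hq' : q ∈ φ'.source) (hS : q ∈ range ι) :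
    ∀ᶠ q' in 𝓝 q, q' ∉ range ι → 0 < ((relSign ι φ φ' q : ℤ) : ℝ) * (φ q' 0 * φ' q' 0) :=
  Classical.epsilon_spec (h.exists_relSign h' hq hq' hS)

/-- A sign determined by a condition off the hypersurface near one of its points is unique, since
the complement of the hypersurface accumulates there. -/
theorem IsDefiningChart.eq_of_eventually_pos (h : IsDefiningChart ι φ) (hq : q ∈ φ.source)
    (hS : q ∈ range ι) {ε ε' : ℤˣ} {g : X → ℝ}
    (hε : ∀ᶠ q' in 𝓝 q, q' ∉ range ι → 0 < ((ε : ℤ) : ℝ) * g q')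
    (hε' : ∀ᶠ q' in 𝓝 q, q' ∉ range ι → 0 < ((ε' : ℤ) : ℝ) * g q') : ε = ε' := by
  have h0 : φ q 0 = 0 := (h.mem_range_iff q hq).1 hS
  obtain ⟨q', hpos, h1, h2, hs⟩ := ((frequently_intUnit_mul_normalCoord_pos hq h0 1).and_eventually
    (hε.and (hε'.and (φ.open_source.mem_nhds hq)))).exists
  have hqS : q' ∉ range ι := fun hS' => by
    simp [(h.mem_range_iff q' hs).1 hS'] at hpos
  exact intUnit_eq_of_pos (h1 hqS) (h2 hqS)

theorem mem_maximalAtlas_restr_addRight [IsManifold (𝓡 (N + 1)) ∞ X]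
    (hφ : φ ∈ IsManifold.maximalAtlas (𝓡 (N + 1)) ∞ X) {s : Set X} (hs : IsOpen s)
    (w : EuclideanSpace ℝ (Fin (N + 1))) :
    (φ.restrOpen s hs).transHomeomorph (Homeomorph.addRight w) ∈
      IsManifold.maximalAtlas (𝓡 (N + 1)) ∞ X := by
  rw [IsManifold.mem_maximalAtlas_iff_contMDiffOn]
  constructor
  · have h1 := contMDiffOn_of_mem_maximalAtlas hφ
    have h2 : ContMDiff (𝓡 (N + 1)) (𝓡 (N + 1)) ∞ fun v : EuclideanSpace ℝ (Fin (N + 1)) =>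
      v + w := (contDiff_id.add contDiff_const).contMDiff
    exact h2.comp_contMDiffOn (h1.mono inter_subset_left)
  · have h1 := contMDiffOn_symm_of_mem_maximalAtlas hφ
    have h2 : ContMDiff (𝓡 (N + 1)) (𝓡 (N + 1)) ∞ fun v : EuclideanSpace ℝ (Fin (N + 1)) =>
      v + -w := (contDiff_id.add contDiff_const).contMDiff
    exact h1.comp h2.contMDiffOn fun x hx => hx.1

/-- Off the hypersurface, a translate of a restriction of any chart is a defining chart, on which
the normal coordinate is positive. -/
theorem exists_isDefiningChart_of_notMem [IsManifold (𝓡 (N + 1)) ∞ X] (hcl : IsClosed (range ι))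
    (hφ : φ ∈ IsManifold.maximalAtlas (𝓡 (N + 1)) ∞ X) (hq : q ∈ φ.source) (hS : q ∉ range ι) :
    ∃ (s : Set X) (hs : IsOpen s) (w : EuclideanSpace ℝ (Fin (N + 1))),
      IsDefiningChart ι ((φ.restrOpen s hs).transHomeomorph (Homeomorph.addRight w)) ∧ q ∈ s ∧
        s ⊆ φ.source ∧ ∀ q' ∈ s, 0 < (φ q' + w) 0 := by
  set s : Set X := (φ.source ∩ φ ⁻¹' {v | φ q 0 - 1 < v 0}) ∩ (range ι)ᶜ
  have hs : IsOpen s := (φ.isOpen_inter_preimage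
    (isOpen_lt continuous_const (by fun_prop))).inter hcl.isOpen_compl
  -- The domain is cut down to `x > x(q) - 1`, which this translation moves into `x > 0`.
  set w : EuclideanSpace ℝ (Fin (N + 1)) := sliceVec (1 - φ q 0) 0 with hw
  have hpos : ∀ q' ∈ s, 0 < (φ q' + w) 0 := fun q' hq' => by
    have : φ q 0 - 1 < φ q' 0 := hq'.1.2
    simp only [hw, PiLp.add_apply, sliceVec_zero_apply]
    linarith
  refine ⟨s, hs, w, ⟨mem_maximalAtlas_restr_addRight hφ hs w, fun q' hq' => ?_⟩,
    ⟨⟨hq, by simp⟩, hS⟩, fun q' hq' => hq'.1.1, hpos⟩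
  have hq's : q' ∈ s := hq'.2
  exact ⟨fun h => absurd h hq's.2, fun h => absurd h (hpos q' hq's).ne'⟩

end Charts

/-! ### Pull-back of contact forms by local diffeomorphisms -/

theorem IsContactForm.pullback {N : ℕ} {Z' Z : Type*} [TopologicalSpace Z']
    [ChartedSpace (EuclideanSpace ℝ (Fin N)) Z'] [IsManifold (𝓡 N) ∞ Z'] [TopologicalSpace Z]
    [ChartedSpace (EuclideanSpace ℝ (Fin N)) Z] [IsManifold (𝓡 N) ∞ Z] {p : Z' → Z}
    (hp : IsLocalDiffeomorph (𝓡 N) (𝓡 N) ∞ p) {α : ∀ z : Z, TangentSpace (𝓡 N) z →L[ℝ] ℝ}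
    (hα : IsContactForm N α) : IsContactForm N (pullbackOneForm N p α) := by
  intro z
  obtain ⟨Φ, hzΦ, hΦ⟩ := hp z
  obtain ⟨ψ, hψ, hz, a, ha, hαa, hnd⟩ := hα (p z)
  have hψc := contMDiffOn_of_mem_maximalAtlas hψ
  set e : OpenPartialHomeomorph Z' (EuclideanSpace ℝ (Fin N)) :=
    Φ.toOpenPartialHomeomorph.trans ψ with he
  have hsrc : ∀ z' ∈ e.source, z' ∈ Φ.source ∧ p z' ∈ ψ.source := fun z' hz' =>
    ⟨hz'.1, by rw [hΦ hz'.1]; exact hz'.2⟩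
  have hesrc : ∀ z' ∈ Φ.source, p z' ∈ ψ.source → z' ∈ e.source := fun z' h1 h2 =>
    ⟨h1, by rw [hΦ h1] at h2; exact h2⟩
  have heq : ∀ z' ∈ e.source, e z' = ψ (p z') := fun z' hz' => by
    rw [hΦ hz'.1]; rfl
  refine ⟨e, e.mem_maximalAtlas_of_contMDiffOn ?_ ?_, hesrc z hzΦ hz, a,
    ha.mono fun y hy => hy.1, fun z' hz' v => ?_, fun y hy => hnd y hy.1⟩
  · exact hψc.comp (Φ.contMDiffOn_toFun.mono fun z' hz' => hz'.1) fun z' hz' => hz'.2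
  · exact Φ.contMDiffOn_invFun.comp
      ((contMDiffOn_symm_of_mem_maximalAtlas hψ).mono fun y hy => hy.1) fun y hy => hy.2
  · obtain ⟨h1, h2⟩ := hsrc z' hz'
    have hpd : MDifferentiableAt (𝓡 N) (𝓡 N) p z' := (hp z').mdifferentiableAt (by simp)
    have hψd : MDifferentiableAt (𝓡 N) 𝓘(ℝ, EuclideanSpace ℝ (Fin N)) ψ (p z') :=
      (contMDiffAt_of_mem_maximalAtlas hψ h2).mdifferentiableAt (by simp)
    have hev : (e : Z' → EuclideanSpace ℝ (Fin N)) =ᶠ[𝓝 z'] ψ ∘ p := by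
      filter_upwards [e.open_source.mem_nhds hz'] with z'' hz'' using heq z'' hz''
    rw [hev.mfderiv_eq, mfderiv_comp z' hψd hpd, heq z' hz']
    exact hαa (p z') h2 _

/-! ### The blow-up as a smooth manifold with boundary -/

/-- A closed embedded hypersurface, covered by adapted charts. -/
structure IsHypersurface {N : ℕ} {X : Type u} [TopologicalSpace X]
    [ChartedSpace (EuclideanSpace ℝ (Fin (N + 1))) X] {Z : Type v} [TopologicalSpace Z]
    [ChartedSpace (EuclideanSpace ℝ (Fin N)) Z] (ι : Z → X) : Prop where
  isEmbedding : IsEmbedding ι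
  isClosed_range : IsClosed (range ι)
  exists_sliceChart : ∀ z : Z, ∃ φ ψ, IsSliceChart (𝓡 (N + 1)) ι φ ψ ∧ z ∈ ψ.source

variable {N : ℕ} {X : Type u} [TopologicalSpace X]
  [ChartedSpace (EuclideanSpace ℝ (Fin (N + 1))) X] {Z : Type v} [TopologicalSpace Z]
  [ChartedSpace (EuclideanSpace ℝ (Fin N)) Z] {ι : Z → X}
  {φ φ' : OpenPartialHomeomorph X (EuclideanSpace ℝ (Fin (N + 1)))} {q : X}

/-- The points of the real oriented blow-up of `X` along the hypersurface `ι`: a point `pt` of `X`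
and, if it lies on the hypersurface, one of its two sides there. The sides of the hypersurface at
`pt` are labelled by the sign of the normal coordinate of a reference chart chosen at `pt`, so a
label has no meaning across different points; the topology is defined through charts. -/
structure BlowUp (h : IsHypersurface (N := N) ι) : Type (max u v) where
  /-- The image in `X`. -/
  pt : X
  /-- The label of the side. -/
  side : ℤˣ
  side_eq : pt ∉ range ι → side = 1

namespace IsHypersurface

variable [IsManifold (𝓡 (N + 1)) ∞ X] (h : IsHypersurface (N := N) ι)

include h in
theorem exists_isDefiningChart (q : X) :
    ∃ φ : OpenPartialHomeomorph X (EuclideanSpace ℝ (Fin (N + 1))),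
      IsDefiningChart ι φ ∧ q ∈ φ.source := by
  by_cases hq : q ∈ range ι
  · obtain ⟨z, rfl⟩ := hq
    obtain ⟨φ, ψ, hφ, hz⟩ := h.exists_sliceChart z
    rw [hφ.source_eq] at hz
    exact ⟨φ, hφ.isDefiningChart, hz⟩
  · obtain ⟨s, hs, w, hd, hqs, hsub, -⟩ := exists_isDefiningChart_of_notMem h.isClosed_range
      (IsManifold.chart_mem_maximalAtlas (I := 𝓡 (N + 1)) (n := ∞) q)
      (mem_chart_source (EuclideanSpace ℝ (Fin (N + 1))) q) hq
    exact ⟨_, hd, hsub hqs, hqs⟩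

/-- A chosen defining chart around each point. -/
def refChart (q : X) : OpenPartialHomeomorph X (EuclideanSpace ℝ (Fin (N + 1))) :=
  (h.exists_isDefiningChart q).choose

theorem isDefiningChart_refChart (q : X) : IsDefiningChart ι (h.refChart q) :=
  (h.exists_isDefiningChart q).choose_spec.1

theorem mem_refChart_source (q : X) : q ∈ (h.refChart q).source :=
  (h.exists_isDefiningChart q).choose_spec.2

/-- The label, at the point `q` of the hypersurface, of the side on which the normal coordinate of
`φ` is positive: the sign of this coordinate relative to that of the reference chart at `q`. -/
def side (φ : OpenPartialHomeomorph X (EuclideanSpace ℝ (Fin (N + 1)))) (q : X) : ℤˣ :=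
  relSign ι (h.refChart q) φ q

theorem side_mul_side_spec (hφ : IsDefiningChart ι φ) (hφ' : IsDefiningChart ι φ')
    (hq : q ∈ φ.source) (hq' : q ∈ φ'.source) (hS : q ∈ range ι) :
    ∀ᶠ q' in 𝓝 q, q' ∉ range ι →
      0 < (((h.side φ q * h.side φ' q : ℤˣ) : ℤ) : ℝ) * (φ q' 0 * φ' q' 0) := by
  filter_upwards [(h.isDefiningChart_refChart q).relSign_spec hφ (h.mem_refChart_source q) hq hS,
    (h.isDefiningChart_refChart q).relSign_spec hφ' (h.mem_refChart_source q) hq' hS]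
    with q' h1 h2 hq'S
  have h3 := mul_pos (h1 hq'S) (h2 hq'S)
  -- The product of the two signs relates `φ` and `φ'` up to the square of the reference coordinate.
  have h4 : 0 ≤ (h.refChart q) q' 0 ^ 2 := sq_nonneg _
  refine pos_of_mul_pos_left (b := (h.refChart q) q' 0 ^ 2) ?_ h4
  calc 0 < _ := h3
    _ = _ := by simp only [side, Units.val_mul, Int.cast_mul]; ring

/-- The sides of two defining charts compare in a locally constant way along the hypersurface. -/
theorem eventually_side_mul_side (hφ : IsDefiningChart ι φ) (hφ' : IsDefiningChart ι φ')
    (hq : q ∈ φ.source) (hq' : q ∈ φ'.source) (hS : q ∈ range ι) :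
    ∀ᶠ q' in 𝓝 q, q' ∈ range ι →
      h.side φ q' * h.side φ' q' = h.side φ q * h.side φ' q := by
  filter_upwards [(h.side_mul_side_spec hφ hφ' hq hq' hS).eventually_nhds,
    φ.open_source.mem_nhds hq, φ'.open_source.mem_nhds hq'] with q' h1 h2 h3 hq'S
  exact hφ.eq_of_eventually_pos h2 hq'S (h.side_mul_side_spec hφ hφ' h2 h3 hq'S) h1

end IsHypersurface

theorem intUnit_mul_eq_mul_iff : ∀ {a b c d : ℤˣ}, a * b = c * d ↔ b * d = a * c := by decide

namespace BlowUp

variable {h : IsHypersurface (N := N) ι}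

@[ext] theorem ext {p p' : BlowUp h} (h1 : p.pt = p'.pt) (h2 : p.side = p'.side) : p = p' := by
  cases p; cases p'; simp_all

theorem ext_of_notMem {p p' : BlowUp h} (h1 : p.pt = p'.pt) (h2 : p.pt ∉ range ι) : p = p' :=
  BlowUp.ext h1 ((p.side_eq h2).trans (p'.side_eq (h1 ▸ h2)).symm)

variable [IsManifold (𝓡 (N + 1)) ∞ X]

/-- The part of the blow-up over the domain of `φ` which is on the side `θ x ≥ 0` of the
hypersurface, where `x` is the normal coordinate of `φ`. -/
def sheet (h : IsHypersurface (N := N) ι)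
    (φ : OpenPartialHomeomorph X (EuclideanSpace ℝ (Fin (N + 1)))) (θ : ℤˣ) : Set (BlowUp h) :=
  {p | p.pt ∈ φ.source ∧ (p.pt ∉ range ι → 0 < ((θ : ℤ) : ℝ) * φ p.pt 0) ∧
    (p.pt ∈ range ι → p.side = θ * h.side φ p.pt)}

/-- The point of the blow-up with polar coordinates `u` on the side `θ` of the chart `φ`. -/
def ofPolar (h : IsHypersurface (N := N) ι)
    (φ : OpenPartialHomeomorph X (EuclideanSpace ℝ (Fin (N + 1)))) (θ : ℤˣ)
    (u : EuclideanHalfSpace (N + 1)) : BlowUp h := by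
  classical exact
  { pt := φ.symm (polar θ u)
    side := if φ.symm (polar θ u) ∈ range ι then θ * h.side φ (φ.symm (polar θ u)) else 1
    side_eq := fun hq => if_neg hq }

/-- Polar coordinates on the blow-up; the radius is `|x|`, where `x` is the normal coordinate. -/
def toPolar (φ : OpenPartialHomeomorph X (EuclideanSpace ℝ (Fin (N + 1)))) (p : BlowUp h) :
    EuclideanHalfSpace (N + 1) :=
  ⟨sliceVec |φ p.pt 0| (tail (φ p.pt)), abs_nonneg _⟩

theorem intUnit_mul_normalCoord_nonneg (hφ : IsDefiningChart ι φ) {θ : ℤˣ} {p : BlowUp h}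
    (hp : p ∈ sheet h φ θ) : 0 ≤ ((θ : ℤ) : ℝ) * φ p.pt 0 := by
  by_cases hS : p.pt ∈ range ι
  · rw [(hφ.mem_range_iff _ hp.1).1 hS, mul_zero]
  · exact (hp.2.1 hS).le

theorem toPolar_val (hφ : IsDefiningChart ι φ) {θ : ℤˣ} {p : BlowUp h}
    (hp : p ∈ sheet h φ θ) : (toPolar φ p).1 = reflect θ (φ p.pt) := by
  have h0 : |φ p.pt 0| = ((θ : ℤ) : ℝ) * φ p.pt 0 := by
    rw [← abs_of_nonneg (intUnit_mul_normalCoord_nonneg hφ hp), abs_mul]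
    rcases Int.units_eq_one_or θ with rfl | rfl <;> simp
  rw [← sliceVec_tail (reflect θ (φ p.pt)), reflect_apply_zero, ← h0]
  rfl

theorem polar_toPolar (hφ : IsDefiningChart ι φ) {θ : ℤˣ} {p : BlowUp h}
    (hp : p ∈ sheet h φ θ) : polar θ (toPolar φ p) = φ p.pt := by
  rw [polar_eq_reflect, toPolar_val hφ hp, reflect_reflect]

@[simp] theorem ofPolar_pt (θ : ℤˣ) (u : EuclideanHalfSpace (N + 1)) :
    (ofPolar h φ θ u).pt = φ.symm (polar θ u) := rfl

theorem ofPolar_side {θ : ℤˣ} {u : EuclideanHalfSpace (N + 1)}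
    (hS : φ.symm (polar θ u) ∈ range ι) :
    (ofPolar h φ θ u).side = θ * h.side φ (φ.symm (polar θ u)) := if_pos hS

theorem ofPolar_mem_sheet (hφ : IsDefiningChart ι φ) {θ : ℤˣ} {u : EuclideanHalfSpace (N + 1)}
    (hu : polar θ u ∈ φ.target) : ofPolar h φ θ u ∈ sheet h φ θ := by
  refine ⟨φ.map_target hu, fun hS => ?_, fun hS => ofPolar_side hS⟩
  have h0 : φ (φ.symm (polar θ u)) 0 ≠ 0 := fun h0 =>
    hS ((hφ.mem_range_iff _ (φ.map_target hu)).2 h0)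
  rw [ofPolar_pt]
  rw [φ.right_inv hu, polar_eq_reflect, reflect_apply_zero] at h0 ⊢
  rw [← mul_assoc, intUnit_mul_self, one_mul]
  exact lt_of_le_of_ne u.2 (Ne.symm (right_ne_zero_of_mul h0))

/-- Polar coordinates as a chart of the blow-up, which does not yet carry a topology. -/
def polarEquiv (h : IsHypersurface (N := N) ι) (hφ : IsDefiningChart ι φ) (θ : ℤˣ) :
    PartialEquiv (BlowUp h) (EuclideanHalfSpace (N + 1)) where
  toFun := toPolar φ
  invFun := ofPolar h φ θ
  source := sheet h φ θ
  target := polar θ ⁻¹' φ.target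
  map_source' p hp := by
    rw [mem_preimage, polar_toPolar hφ hp]
    exact φ.map_source hp.1
  map_target' u hu := ofPolar_mem_sheet hφ hu
  left_inv' p hp := by
    have hpt : (ofPolar h φ θ (toPolar φ p)).pt = p.pt := by
      rw [ofPolar_pt, polar_toPolar hφ hp, φ.left_inv hp.1]
    by_cases hS : p.pt ∈ range ι
    · refine BlowUp.ext hpt ?_
      rw [ofPolar_side (by rwa [← ofPolar_pt (h := h), hpt]), ← ofPolar_pt (h := h), hpt,
        hp.2.2 hS]
    · exact ext_of_notMem hpt (hpt ▸ hS)
  right_inv' u hu := by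
    refine Subtype.ext ?_
    rw [toPolar_val hφ (ofPolar_mem_sheet hφ hu), ofPolar_pt, φ.right_inv hu, polar_eq_reflect,
      reflect_reflect]

/-- At a point over the hypersurface, this is where the sides of `φ` and `φ'` must compare locally
constantly, both along the hypersurface and with the nearby points off it. -/
theorem isOpen_polarEquiv_trans_source (hφ : IsDefiningChart ι φ) (hφ' : IsDefiningChart ι φ')
    (θ θ' : ℤˣ) : IsOpen ((polarEquiv h hφ θ).symm.trans (polarEquiv h hφ' θ')).source := by
  rw [isOpen_iff_mem_nhds]
  rintro u ⟨hu, hu'⟩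
  have hu : polar θ u ∈ φ.target := hu
  have hu' : ofPolar h φ θ u ∈ sheet h φ' θ' := hu'
  set G : EuclideanHalfSpace (N + 1) → X := fun u => φ.symm (polar θ u) with hG
  have hGc : Tendsto G (𝓝 u) (𝓝 (G u)) :=
    (φ.symm.continuousAt hu).comp (continuous_polar θ).continuousAt
  have hq' : G u ∈ φ'.source := hu'.1
  have e1 : ∀ᶠ u' in 𝓝 u, polar θ u' ∈ φ.target :=
    (continuous_polar θ).continuousAt (φ.open_target.mem_nhds hu)
  have e2 : ∀ᶠ u' in 𝓝 u, G u' ∈ φ'.source := hGc (φ'.open_source.mem_nhds hq')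
  suffices e3 : ∀ᶠ u' in 𝓝 u, polar θ u' ∈ φ.target →
      (G u' ∉ range ι → 0 < ((θ' : ℤ) : ℝ) * φ' (G u') 0) ∧
      (G u' ∈ range ι → θ * h.side φ (G u') = θ' * h.side φ' (G u')) by
    filter_upwards [e1, e2, e3] with u' h1 h2 h3
    refine ⟨h1, h2, (h3 h1).1, fun hS => ?_⟩
    exact (ofPolar_side hS).trans ((h3 h1).2 hS)
  by_cases hS : G u ∈ range ι
  · have hs : h.side φ (G u) * h.side φ' (G u) = θ * θ' := by
      rw [← intUnit_mul_eq_mul_iff]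
      exact (ofPolar_side hS).symm.trans (hu'.2.2 hS)
    have hq : G u ∈ φ.source := φ.map_target hu
    filter_upwards [hGc.eventually (h.side_mul_side_spec hφ hφ' hq hq' hS),
      hGc.eventually (h.eventually_side_mul_side hφ hφ' hq hq' hS)] with u' h1 h2 h3
    refine ⟨fun hS' => ?_, fun hS' => ?_⟩
    · have h4 := h1 hS'
      have h5 : φ (G u') 0 = ((θ : ℤ) : ℝ) * u'.1 0 := by
        rw [hG, φ.right_inv h3, polar_eq_reflect, reflect_apply_zero]
      refine pos_of_mul_pos_left (b := u'.1 0) ?_ u'.2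
      rw [hs, h5, Units.val_mul, Int.cast_mul] at h4
      calc 0 < _ := h4
        _ = ((θ : ℤ) : ℝ) * ((θ : ℤ) : ℝ) * ((((θ' : ℤ) : ℝ) * φ' (G u') 0) * u'.1 0) := by ring
        _ = _ := by rw [intUnit_mul_self, one_mul]
    · rw [intUnit_mul_eq_mul_iff, h2 hS', hs]
  · have hc : ContinuousAt (fun q' => ((θ' : ℤ) : ℝ) * φ' q' 0) (G u) := by
      refine continuousAt_const.mul ?_
      exact ContinuousAt.comp (g := fun v : EuclideanSpace ℝ (Fin (N + 1)) => v 0)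
        (by fun_prop) (φ'.continuousAt hq')
    filter_upwards [hGc.eventually (h.isClosed_range.isOpen_compl.mem_nhds hS),
      hGc.eventually (hc.eventually (lt_mem_nhds (hu'.2.1 hS)))] with u' h1 h2 _
    exact ⟨fun _ => h2, fun h3 => absurd h3 h1⟩

theorem polarEquiv_trans_val (hφ : IsDefiningChart ι φ) (hφ' : IsDefiningChart ι φ')
    {θ θ' : ℤˣ} {u : EuclideanHalfSpace (N + 1)}
    (hu : u ∈ ((polarEquiv h hφ θ).symm.trans (polarEquiv h hφ' θ')).source) :
    ((polarEquiv h hφ θ).symm.trans (polarEquiv h hφ' θ') u).1 =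
      reflect θ' (φ' (φ.symm (reflect θ u.1))) :=
  toPolar_val hφ' hu.2

theorem continuousOn_polarEquiv_trans (hφ : IsDefiningChart ι φ) (hφ' : IsDefiningChart ι φ')
    (θ θ' : ℤˣ) : ContinuousOn ((polarEquiv h hφ θ).symm.trans (polarEquiv h hφ' θ'))
      ((polarEquiv h hφ θ).symm.trans (polarEquiv h hφ' θ')).source := by
  have hval : IsInducing (Subtype.val : EuclideanHalfSpace (N + 1) → _) := ⟨rfl⟩
  rw [hval.continuousOn_iff]
  have h1 : ContinuousOn (fun u : EuclideanHalfSpace (N + 1) => φ.symm (polar θ u))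
      ((polarEquiv h hφ θ).symm.trans (polarEquiv h hφ' θ')).source :=
    φ.symm.continuousOn.comp (continuous_polar θ).continuousOn fun u hu => hu.1
  have h2 : ContinuousOn (fun u : EuclideanHalfSpace (N + 1) =>
      reflect θ' (φ' (φ.symm (polar θ u))))
      ((polarEquiv h hφ θ).symm.trans (polarEquiv h hφ' θ')).source :=
    (reflect θ').continuous.comp_continuousOn (φ'.continuousOn.comp h1 fun u hu => hu.2.1)
  exact h2.congr fun u hu => polarEquiv_trans_val hφ hφ' hu

theorem exists_mem_sheet (hφ : IsDefiningChart ι φ) {p : BlowUp h} (hp : p.pt ∈ φ.source) :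
    ∃ θ, p ∈ sheet h φ θ := by
  by_cases hS : p.pt ∈ range ι
  · refine ⟨p.side * h.side φ p.pt, hp, fun hS' => absurd hS hS', fun _ => ?_⟩
    rw [mul_assoc, Int.units_mul_self, mul_one]
  · have h0 : φ p.pt 0 ≠ 0 := fun h0 => hS ((hφ.mem_range_iff _ hp).2 h0)
    rcases lt_or_gt_of_ne h0 with hlt | hgt
    · exact ⟨-1, hp, fun _ => by simpa using hlt, fun hS' => absurd hS' hS⟩
    · exact ⟨1, hp, fun _ => by simpa using hgt, fun hS' => absurd hS' hS⟩

theorem eq_of_mem_sheet {θ θ' : ℤˣ} {p : BlowUp h} (hp : p ∈ sheet h φ θ)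
    (hp' : p ∈ sheet h φ θ') : θ = θ' := by
  by_cases hS : p.pt ∈ range ι
  · exact mul_right_cancel ((hp.2.2 hS).symm.trans (hp'.2.2 hS))
  · exact intUnit_eq_of_pos (hp.2.1 hS) (hp'.2.1 hS)

/-- The blow-up as a charted space built from polar coordinates. -/
def core (h : IsHypersurface (N := N) ι) :
    ChartedSpaceCore (EuclideanHalfSpace (N + 1)) (BlowUp h) where
  atlas := {e | ∃ (φ : OpenPartialHomeomorph X (EuclideanSpace ℝ (Fin (N + 1))))
    (hφ : IsDefiningChart ι φ) (θ : ℤˣ), e = polarEquiv h hφ θ}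
  chartAt p := polarEquiv h (h.isDefiningChart_refChart p.pt)
    (exists_mem_sheet (h.isDefiningChart_refChart p.pt) (h.mem_refChart_source p.pt)).choose
  mem_chart_source p :=
    (exists_mem_sheet (h.isDefiningChart_refChart p.pt) (h.mem_refChart_source p.pt)).choose_spec
  chart_mem_atlas p := ⟨_, _, _, rfl⟩
  open_source := by
    rintro _ _ ⟨φ, hφ, θ, rfl⟩ ⟨φ', hφ', θ', rfl⟩
    exact isOpen_polarEquiv_trans_source hφ hφ' θ θ'
  continuousOn_toFun := by
    rintro _ _ ⟨φ, hφ, θ, rfl⟩ ⟨φ', hφ', θ', rfl⟩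
    exact continuousOn_polarEquiv_trans hφ hφ' θ θ'

instance : TopologicalSpace (BlowUp h) := (core h).toTopologicalSpace

instance : ChartedSpace (EuclideanHalfSpace (N + 1)) (BlowUp h) := (core h).toChartedSpace

/-- Polar coordinates on the side `θ` of the defining chart `φ`, as a chart of the blow-up. -/
def polarChart (h : IsHypersurface (N := N) ι) (hφ : IsDefiningChart ι φ) (θ : ℤˣ) :
    OpenPartialHomeomorph (BlowUp h) (EuclideanHalfSpace (N + 1)) :=
  (core h).openPartialHomeomorph (polarEquiv h hφ θ) ⟨φ, hφ, θ, rfl⟩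

@[simp] theorem polarChart_target (hφ : IsDefiningChart ι φ) (θ : ℤˣ) :
    (polarChart h hφ θ).target = polar θ ⁻¹' φ.target := rfl

theorem polarChart_val (hφ : IsDefiningChart ι φ) {θ : ℤˣ} {p : BlowUp h}
    (hp : p ∈ sheet h φ θ) : (polarChart h hφ θ p).1 = reflect θ (φ p.pt) := toPolar_val hφ hp

theorem polar_polarChart (hφ : IsDefiningChart ι φ) {θ : ℤˣ} {p : BlowUp h}
    (hp : p ∈ sheet h φ θ) : polar θ (polarChart h hφ θ p) = φ p.pt := polar_toPolar hφ hp

theorem isOpen_sheet (hφ : IsDefiningChart ι φ) (θ : ℤˣ) : IsOpen (sheet h φ θ) :=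
  (polarChart h hφ θ).open_source

theorem mem_atlas_iff (e : OpenPartialHomeomorph (BlowUp h) (EuclideanHalfSpace (N + 1))) :
    e ∈ atlas (EuclideanHalfSpace (N + 1)) (BlowUp h) ↔
      ∃ (φ : OpenPartialHomeomorph X (EuclideanSpace ℝ (Fin (N + 1))))
        (hφ : IsDefiningChart ι φ) (θ : ℤˣ), e = polarChart h hφ θ := by
  change e ∈ ⋃ (e : PartialEquiv (BlowUp h) (EuclideanHalfSpace (N + 1)))
    (he : e ∈ (core h).atlas), {(core h).openPartialHomeomorph e he} ↔ _
  simp only [mem_iUnion, mem_singleton_iff]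
  constructor
  · rintro ⟨_, ⟨φ, hφ, θ, rfl⟩, rfl⟩
    exact ⟨φ, hφ, θ, rfl⟩
  · rintro ⟨φ, hφ, θ, rfl⟩
    exact ⟨_, ⟨φ, hφ, θ, rfl⟩, rfl⟩

theorem polarChart_mem_atlas (hφ : IsDefiningChart ι φ) (θ : ℤˣ) :
    polarChart h hφ θ ∈ atlas (EuclideanHalfSpace (N + 1)) (BlowUp h) :=
  (mem_atlas_iff _).2 ⟨φ, hφ, θ, rfl⟩

theorem continuous_pt : Continuous (pt : BlowUp h → X) := by
  rw [continuous_iff_continuousAt]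
  intro p
  have hφ := h.isDefiningChart_refChart p.pt
  obtain ⟨θ, hp⟩ := exists_mem_sheet hφ (h.mem_refChart_source p.pt)
  have h1 : ContinuousAt (fun p' : BlowUp h =>
      (h.refChart p.pt).symm (polar θ (polarChart h hφ θ p'))) p := by
    refine ContinuousAt.comp' ?_
      ((continuous_polar θ).continuousAt.comp ((polarChart h hφ θ).continuousAt hp))
    refine (h.refChart p.pt).symm.continuousAt ?_
    rw [OpenPartialHomeomorph.symm_source]
    exact (polarChart h hφ θ).map_source hp
  refine h1.congr ?_
  filter_upwards [(isOpen_sheet hφ θ).mem_nhds hp] with p' hp'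
  rw [polar_polarChart hφ hp', OpenPartialHomeomorph.left_inv _ hp'.1]

instance [T2Space X] : T2Space (BlowUp h) := by
  refine ⟨fun p p' hne => ?_⟩
  by_cases hpt : p.pt = p'.pt
  · have hφ := h.isDefiningChart_refChart p.pt
    obtain ⟨θ, hp⟩ := exists_mem_sheet hφ (h.mem_refChart_source p.pt)
    obtain ⟨θ', hp'⟩ := exists_mem_sheet (p := p') hφ (hpt ▸ h.mem_refChart_source p.pt)
    refine ⟨_, _, isOpen_sheet hφ θ, isOpen_sheet hφ θ', hp, hp', ?_⟩
    rw [Set.disjoint_left]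
    intro x hx hx'
    have hθ := eq_of_mem_sheet hx hx'
    subst hθ
    refine hne ?_
    by_cases hS : p.pt ∈ range ι
    · refine BlowUp.ext hpt ?_
      rw [hp.2.2 hS, hp'.2.2 (hpt ▸ hS), hpt]
    · exact ext_of_notMem hpt hS
  · obtain ⟨U, V, hU, hV, h1, h2, h3⟩ := t2_separation hpt
    exact ⟨_, _, hU.preimage continuous_pt, hV.preimage continuous_pt, h1, h2, h3.preimage pt⟩

instance : SecondCountableTopology (EuclideanHalfSpace (N + 1)) :=
  inferInstanceAs (SecondCountableTopology {x : EuclideanSpace ℝ (Fin (N + 1)) // 0 ≤ x 0})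

instance [SecondCountableTopology X] : SecondCountableTopology (BlowUp h) := by
  obtain ⟨s, hs, hcov⟩ := TopologicalSpace.countable_cover_nhds fun q : X =>
    (h.refChart q).open_source.mem_nhds (h.mem_refChart_source q)
  have := hs.to_subtype
  have (i : s × ℤˣ) : SecondCountableTopology (sheet h (h.refChart i.1) i.2) :=
    (polarChart h (h.isDefiningChart_refChart i.1) i.2).secondCountableTopology_source
  refine TopologicalSpace.secondCountableTopology_of_countable_cover
    (U := fun i : s × ℤˣ => sheet h (h.refChart i.1) i.2)
    (fun i => isOpen_sheet (h.isDefiningChart_refChart _) i.2) ?_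
  refine eq_univ_of_forall fun p => ?_
  obtain ⟨q, hqs, hq⟩ := mem_iUnion₂.1 (hcov.symm ▸ mem_univ p.pt : p.pt ∈ ⋃ x ∈ s, _)
  obtain ⟨θ, hθ⟩ := exists_mem_sheet (h.isDefiningChart_refChart q) hq
  exact mem_iUnion.2 ⟨(⟨q, hqs⟩, θ), hθ⟩

/-- The transition maps are, up to reflections, transition maps of `X`. -/
instance : IsManifold (𝓡∂ (N + 1)) ∞ (BlowUp h) := by
  refine isManifold_of_contDiffOn _ _ _ fun e e' he he' => ?_
  obtain ⟨φ, hφ, θ, rfl⟩ := (mem_atlas_iff _).1 he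
  obtain ⟨φ', hφ', θ', rfl⟩ := (mem_atlas_iff _).1 he'
  set s := (𝓡∂ (N + 1)).symm ⁻¹' ((polarChart h hφ θ).symm ≫ₕ polarChart h hφ' θ').source ∩
    range (𝓡∂ (N + 1))
  have hval : ∀ x ∈ s, ((𝓡∂ (N + 1)).symm x).1 = x := fun x hx =>
    (𝓡∂ (N + 1)).right_inv hx.2
  have h1 : ContDiffOn ℝ ∞ (φ' ∘ φ.symm) (φ.target ∩ φ.symm ⁻¹' φ'.source) := by
    rw [← contMDiffOn_iff_contDiffOn]
    exact (contMDiffOn_of_mem_maximalAtlas hφ'.mem_atlas).comp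
      ((contMDiffOn_symm_of_mem_maximalAtlas hφ.mem_atlas).mono inter_subset_left)
      inter_subset_right
  have h2 : ContDiffOn ℝ ∞ (fun x => reflect θ' ((φ' ∘ φ.symm) (reflect θ x))) s := by
    refine (reflect θ').contDiff.comp_contDiffOn
      (h1.comp (reflect θ).contDiff.contDiffOn fun x hx => ?_)
    have hx1 : polar θ ((𝓡∂ (N + 1)).symm x) ∈ φ.target := hx.1.1
    have hx2 : φ.symm (polar θ ((𝓡∂ (N + 1)).symm x)) ∈ φ'.source := hx.1.2.1
    rw [polar_eq_reflect, hval x hx] at hx1 hx2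
    exact ⟨hx1, hx2⟩
  refine h2.congr fun x hx => ?_
  have := polarEquiv_trans_val (h := h) hφ hφ' (u := (𝓡∂ (N + 1)).symm x) hx.1
  rw [hval x hx] at this
  exact this

theorem polarChart_mem_maximalAtlas (hφ : IsDefiningChart ι φ) (θ : ℤˣ) :
    polarChart h hφ θ ∈ IsManifold.maximalAtlas (𝓡∂ (N + 1)) ∞ (BlowUp h) :=
  IsManifold.subset_maximalAtlas (polarChart_mem_atlas hφ θ)

end BlowUp

theorem IsSliceChart.apply_eq_sliceVec {ψ : OpenPartialHomeomorph Z (EuclideanSpace ℝ (Fin N))}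
    (hs : IsSliceChart (𝓡 (N + 1)) ι φ ψ) {z : Z} (hz : z ∈ ψ.source) :
    φ (ι z) = sliceVec 0 (ψ z) := hs.apply_eq z hz

/-! ### The blow-down map -/

namespace BlowUp

variable [IsManifold (𝓡 (N + 1)) ∞ X] {h : IsHypersurface (N := N) ι}

theorem contMDiff_pt : ContMDiff (𝓡∂ (N + 1)) (𝓡 (N + 1)) ∞ (pt : BlowUp h → X) := by
  intro p
  have hφ := h.isDefiningChart_refChart p.pt
  obtain ⟨θ, hp⟩ := exists_mem_sheet hφ (h.mem_refChart_source p.pt)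
  have h1 : ContMDiffAt (𝓡∂ (N + 1)) (𝓡∂ (N + 1)) ∞ (polarChart h hφ θ) p :=
    contMDiffAt_of_mem_maximalAtlas (polarChart_mem_maximalAtlas hφ θ) hp
  have h2 : ContMDiffAt (𝓡∂ (N + 1)) (𝓡 (N + 1)) ∞
      (fun p' => reflect θ ((𝓡∂ (N + 1)) (polarChart h hφ θ p'))) p :=
    (reflect θ).contDiff.contMDiff.contMDiffAt.comp p ((𝓡∂ (N + 1)).contMDiff.contMDiffAt.comp p h1)
  have h3 : ContMDiffAt (𝓡 (N + 1)) (𝓡 (N + 1)) ∞ (h.refChart p.pt).symm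
      (reflect θ ((𝓡∂ (N + 1)) (polarChart h hφ θ p))) :=
    contMDiffAt_symm_of_mem_maximalAtlas hφ.mem_atlas ((polarChart h hφ θ).map_source hp)
  refine (h3.comp p h2).congr_of_eventuallyEq ?_
  filter_upwards [(isOpen_sheet hφ θ).mem_nhds hp] with p' hp'
  exact ((congrArg _ (polar_polarChart hφ hp')).trans
    (OpenPartialHomeomorph.left_inv _ hp'.1)).symm

/-- The inverse of the blow-down map over the complement of the hypersurface. The label is `1` at
every point, as required off the hypersurface; over the hypersurface the value is irrelevant. -/
def lift (h : IsHypersurface (N := N) ι) (q : X) : BlowUp h := ⟨q, 1, fun _ => rfl⟩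

theorem contMDiffOn_lift :
    ContMDiffOn (𝓡 (N + 1)) (𝓡∂ (N + 1)) ∞ (lift h) (range ι)ᶜ := by
  intro q hq
  refine ContMDiffAt.contMDiffWithinAt ?_
  have hφ := h.isDefiningChart_refChart q
  obtain ⟨θ, hp⟩ := exists_mem_sheet (p := lift h q) hφ (h.mem_refChart_source q)
  set φ := h.refChart q
  set s : Set X := φ.source ∩ φ ⁻¹' {v | 0 < ((θ : ℤ) : ℝ) * v 0}
  have hs : IsOpen s := φ.isOpen_inter_preimage (isOpen_lt continuous_const (by fun_prop))
  have hsS : ∀ q' ∈ s, q' ∉ range ι := fun q' hq' hS => by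
    have : 0 < ((θ : ℤ) : ℝ) * φ q' 0 := hq'.2
    rw [(hφ.mem_range_iff q' hq'.1).1 hS, mul_zero] at this
    exact lt_irrefl _ this
  have hsheet : ∀ q' ∈ s, lift h q' ∈ sheet h φ θ := fun q' hq' =>
    ⟨hq'.1, fun _ => hq'.2, fun hS => absurd hS (hsS q' hq')⟩
  have h1 : ContMDiffOn (𝓡 (N + 1)) (𝓡 (N + 1)) ∞ (fun q' => reflect θ (φ q')) s :=
    (reflect θ).contDiff.contMDiff.comp_contMDiffOn
      ((contMDiffOn_of_mem_maximalAtlas hφ.mem_atlas).mono inter_subset_left)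
  have h2 : ContMDiffOn (𝓡 (N + 1)) (𝓡∂ (N + 1)) ∞
      (fun q' => (𝓡∂ (N + 1)).symm (reflect θ (φ q'))) s := by
    refine ((𝓡∂ (N + 1)).contMDiffOn_symm (n := ∞)).comp h1 fun q' hq' => ?_
    exact ⟨polarChart h hφ θ (lift h q'), polarChart_val hφ (hsheet q' hq')⟩
  have heq : ∀ q' ∈ s, (𝓡∂ (N + 1)).symm (reflect θ (φ q')) = polarChart h hφ θ (lift h q') := by
    intro q' hq'
    have : reflect θ (φ q') = (𝓡∂ (N + 1)) (polarChart h hφ θ (lift h q')) :=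
      (polarChart_val hφ (hsheet q' hq')).symm
    rw [this, (𝓡∂ (N + 1)).left_inv]
  have h3 : ContMDiffOn (𝓡 (N + 1)) (𝓡∂ (N + 1)) ∞
      (fun q' => (polarChart h hφ θ).symm ((𝓡∂ (N + 1)).symm (reflect θ (φ q')))) s := by
    refine (contMDiffOn_symm_of_mem_maximalAtlas (polarChart_mem_maximalAtlas hφ θ)).comp h2 ?_
    intro q' hq'
    rw [mem_preimage, heq q' hq']
    exact (polarChart h hφ θ).map_source (hsheet q' hq')
  have hqs : q ∈ s := ⟨h.mem_refChart_source q, hp.2.1 hq⟩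
  refine (h3.congr fun q' hq' => ?_).contMDiffAt (hs.mem_nhds hqs)
  rw [heq q' hq', (polarChart h hφ θ).left_inv (hsheet q' hq')]

theorem isLocalDiffeomorphAt_pt {p : BlowUp h} (hp : p.pt ∉ range ι) :
    IsLocalDiffeomorphAt (𝓡∂ (N + 1)) (𝓡 (N + 1)) ∞ (pt : BlowUp h → X) p :=
  ⟨{ toFun := pt
     invFun := lift h
     source := pt ⁻¹' (range ι)ᶜ
     target := (range ι)ᶜ
     map_source' := fun _ hp => hp
     map_target' := fun _ hq => hq
     left_inv' := fun _ hp => ext_of_notMem rfl hp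
     right_inv' := fun _ _ => rfl
     open_source := h.isClosed_range.isOpen_compl.preimage continuous_pt
     open_target := h.isClosed_range.isOpen_compl
     contMDiffOn_toFun := contMDiff_pt.contMDiffOn
     contMDiffOn_invFun := contMDiffOn_lift }, hp, fun _ _ => rfl⟩

theorem isRealOrientedBlowUp : IsRealOrientedBlowUp N ι (pt : BlowUp h → X) where
  smooth := contMDiff_pt
  bijOn := ⟨fun _ hp => hp, fun _ hp _ _ hpp' => ext_of_notMem hpp' hp,
    fun q hq => ⟨lift h q, hq, rfl⟩⟩
  localDiffeo _ hq := isLocalDiffeomorphAt_pt hq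
  local_model z := by
    obtain ⟨φ, ψ, hs, hz⟩ := h.exists_sliceChart z
    have hφ := hs.isDefiningChart
    refine ⟨φ, ψ, hs, hz, polarChart h hφ, polarChart_mem_maximalAtlas hφ, ?_, ?_, fun _ => rfl,
      fun θ p hp => (polar_polarChart hφ hp).symm⟩
    · rw [Set.disjoint_left]
      intro p hp hp'
      exact absurd (eq_of_mem_sheet hp hp') (by decide)
    · ext p
      refine ⟨fun hp => hp.elim (fun hp => hp.1) fun hp => hp.1, fun hp => ?_⟩
      obtain ⟨θ, hθ⟩ := exists_mem_sheet hφ hp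
      rcases Int.units_eq_one_or θ with rfl | rfl
      exacts [Or.inl hθ, Or.inr hθ]

theorem isBoundaryPoint_iff (p : BlowUp h) :
    (𝓡∂ (N + 1)).IsBoundaryPoint p ↔ p.pt ∈ range ι := by
  have hφ := h.isDefiningChart_refChart p.pt
  have hp := (exists_mem_sheet hφ (h.mem_refChart_source p.pt)).choose_spec
  have hext : extChartAt (𝓡∂ (N + 1)) p p = reflect _ (h.refChart p.pt p.pt) :=
    polarChart_val hφ hp
  rw [ModelWithCorners.isBoundaryPoint_iff, frontier_range_modelWithCornersEuclideanHalfSpace,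
    hφ.mem_range_iff _ hp.1, hext, mem_ofPred_eq, reflect_apply_zero, eq_comm, mul_eq_zero]
  refine or_iff_right ?_
  simp

end BlowUp

/-! ### The double cover of the hypersurface by its sides -/

/-- The pairs of a point of the hypersurface and a side of the hypersurface at that point, labelled
as in `BlowUp`. -/
structure SideCover (h : IsHypersurface (N := N) ι) : Type v where
  /-- The point of the hypersurface. -/
  base : Z
  /-- The label of the side. -/
  side : ℤˣ

namespace SideCover

variable {h : IsHypersurface (N := N) ι} {ψ : OpenPartialHomeomorph Z (EuclideanSpace ℝ (Fin N))}

/-- The inclusion of the sides as the exceptional divisor of the blow-up. It induces the topology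
of `SideCover`. -/
def toBlowUp (z : SideCover h) : BlowUp h :=
  ⟨ι z.base, z.side, fun hz => absurd (mem_range_self _) hz⟩

theorem toBlowUp_injective : Function.Injective (toBlowUp : SideCover h → BlowUp h) := by
  rintro ⟨z, s⟩ ⟨z', s'⟩ heq
  have h1 : ι z = ι z' := congrArg BlowUp.pt heq
  have h2 : s = s' := congrArg BlowUp.side heq
  rw [h.isEmbedding.injective h1, h2]

theorem range_toBlowUp : range (toBlowUp : SideCover h → BlowUp h) = BlowUp.pt ⁻¹' range ι := by
  ext p
  constructor
  · rintro ⟨z, rfl⟩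
    exact mem_range_self _
  · rintro ⟨z, hz⟩
    exact ⟨⟨z, p.side⟩, BlowUp.ext hz rfl⟩

variable [IsManifold (𝓡 (N + 1)) ∞ X]

instance : TopologicalSpace (SideCover h) := TopologicalSpace.induced toBlowUp inferInstance

theorem isEmbedding_toBlowUp : IsEmbedding (toBlowUp : SideCover h → BlowUp h) :=
  ⟨⟨rfl⟩, toBlowUp_injective⟩

instance [T2Space X] : T2Space (SideCover h) := isEmbedding_toBlowUp.t2Space

instance [SecondCountableTopology X] : SecondCountableTopology (SideCover h) :=
  isEmbedding_toBlowUp.secondCountableTopology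

theorem continuous_base : Continuous (base : SideCover h → Z) :=
  h.isEmbedding.continuous_iff.2 (BlowUp.continuous_pt.comp isEmbedding_toBlowUp.continuous)

theorem toBlowUp_mem_sheet_iff (hs : IsSliceChart (𝓡 (N + 1)) ι φ ψ) (θ : ℤˣ) (z : SideCover h) :
    toBlowUp z ∈ BlowUp.sheet h φ θ ↔
      z.base ∈ ψ.source ∧ z.side = θ * h.side φ (ι z.base) := by
  rw [hs.source_eq]
  exact ⟨fun hz => ⟨hz.1, hz.2.2 (mem_range_self _)⟩,
    fun hz => ⟨hz.1, fun hS => absurd (mem_range_self _) hS, fun _ => hz.2⟩⟩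

/-- The inverse of `sideChart`. -/
def ofChart (h : IsHypersurface (N := N) ι)
    (φ : OpenPartialHomeomorph X (EuclideanSpace ℝ (Fin (N + 1))))
    (ψ : OpenPartialHomeomorph Z (EuclideanSpace ℝ (Fin N))) (θ : ℤˣ)
    (y : EuclideanSpace ℝ (Fin N)) : SideCover h :=
  ⟨ψ.symm y, θ * h.side φ (ι (ψ.symm y))⟩

theorem toBlowUp_ofChart (hs : IsSliceChart (𝓡 (N + 1)) ι φ ψ) (θ : ℤˣ)
    {y : EuclideanSpace ℝ (Fin N)} (hy : y ∈ ψ.target) :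
    sliceVec 0 y ∈ φ.target ∧ toBlowUp (ofChart h φ ψ θ y) =
      (BlowUp.polarChart h hs.isDefiningChart θ).symm ⟨sliceVec 0 y, le_rfl⟩ := by
  have hz := ψ.map_target hy
  have h1 : φ (ι (ψ.symm y)) = sliceVec 0 y := by
    rw [hs.apply_eq_sliceVec hz, ψ.right_inv hy]
  rw [hs.source_eq] at hz
  refine ⟨h1 ▸ φ.map_source hz, ?_⟩
  have h2 : φ.symm (polar θ ⟨sliceVec 0 y, le_rfl⟩) = ι (ψ.symm y) := by
    rw [polar_eq_reflect, reflect_sliceVec_zero, ← h1, φ.left_inv hz]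
  refine BlowUp.ext h2.symm ?_
  refine Eq.trans ?_ (BlowUp.ofPolar_side (h := h) (by rw [h2]; exact mem_range_self _)).symm
  rw [h2]
  rfl

/-- The chart `ψ` of the hypersurface, lifted to the side `θ` of the adapted chart `(φ, ψ)`. -/
def sideChart (h : IsHypersurface (N := N) ι) (hs : IsSliceChart (𝓡 (N + 1)) ι φ ψ) (θ : ℤˣ) :
    OpenPartialHomeomorph (SideCover h) (EuclideanSpace ℝ (Fin N)) where
  toFun z := ψ z.base
  invFun := ofChart h φ ψ θ
  source := toBlowUp ⁻¹' BlowUp.sheet h φ θ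
  target := ψ.target
  map_source' z hz := ψ.map_source ((toBlowUp_mem_sheet_iff hs θ z).1 hz).1
  map_target' y hy := (toBlowUp_mem_sheet_iff hs θ _).2 ⟨ψ.map_target hy, rfl⟩
  left_inv' z hz := by
    obtain ⟨h1, h2⟩ := (toBlowUp_mem_sheet_iff hs θ z).1 hz
    cases z
    simp only [ofChart, ψ.left_inv h1]
    rw [← h2]
  right_inv' y hy := ψ.right_inv hy
  open_source := (BlowUp.isOpen_sheet hs.isDefiningChart θ).preimage isEmbedding_toBlowUp.continuous
  open_target := ψ.open_target
  continuousOn_toFun := ψ.continuousOn.comp continuous_base.continuousOn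
    fun z hz => ((toBlowUp_mem_sheet_iff hs θ z).1 hz).1
  continuousOn_invFun := by
    rw [isEmbedding_toBlowUp.isInducing.continuousOn_iff]
    have h1 : Continuous fun y : EuclideanSpace ℝ (Fin N) =>
        (⟨sliceVec 0 y, le_rfl⟩ : EuclideanHalfSpace (N + 1)) :=
      Continuous.subtype_mk (continuous_sliceVec 0) _
    refine ((BlowUp.polarChart h hs.isDefiningChart θ).continuousOn_symm.comp h1.continuousOn
      fun y hy => ?_).congr fun y hy => (toBlowUp_ofChart hs θ hy).2
    change polar θ ⟨sliceVec 0 y, le_rfl⟩ ∈ φ.target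
    rw [polar_eq_reflect, reflect_sliceVec_zero]
    exact (toBlowUp_ofChart (h := h) hs θ hy).1

theorem exists_mem_sideChart_source (hs : IsSliceChart (𝓡 (N + 1)) ι φ ψ) {z : SideCover h}
    (hz : z.base ∈ ψ.source) : ∃ θ, z ∈ (sideChart h hs θ).source := by
  rw [hs.source_eq] at hz
  exact BlowUp.exists_mem_sheet (p := toBlowUp z) hs.isDefiningChart hz

theorem exists_sideChart (z : SideCover h) :
    ∃ (e : OpenPartialHomeomorph (SideCover h) (EuclideanSpace ℝ (Fin N))), z ∈ e.source ∧
      ∃ (φ : OpenPartialHomeomorph X (EuclideanSpace ℝ (Fin (N + 1))))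
        (ψ : OpenPartialHomeomorph Z (EuclideanSpace ℝ (Fin N)))
        (hs : IsSliceChart (𝓡 (N + 1)) ι φ ψ) (θ : ℤˣ), e = sideChart h hs θ := by
  obtain ⟨φ, ψ, hs, hz⟩ := h.exists_sliceChart z.base
  obtain ⟨θ, hθ⟩ := exists_mem_sideChart_source hs hz
  exact ⟨_, hθ, φ, ψ, hs, θ, rfl⟩

instance : ChartedSpace (EuclideanSpace ℝ (Fin N)) (SideCover h) where
  atlas := {e | ∃ (φ : OpenPartialHomeomorph X (EuclideanSpace ℝ (Fin (N + 1))))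
    (ψ : OpenPartialHomeomorph Z (EuclideanSpace ℝ (Fin N)))
    (hs : IsSliceChart (𝓡 (N + 1)) ι φ ψ) (θ : ℤˣ), e = sideChart h hs θ}
  chartAt z := (exists_sideChart z).choose
  mem_chart_source z := (exists_sideChart z).choose_spec.1
  chart_mem_atlas z := (exists_sideChart z).choose_spec.2

instance : IsManifold (𝓡 N) ∞ (SideCover h) := by
  refine isManifold_of_contDiffOn _ _ _ ?_
  rintro _ _ ⟨φ, ψ, hs, θ, rfl⟩ ⟨φ', ψ', hs', θ', rfl⟩
  have h1 : ContDiffOn ℝ ∞ (ψ' ∘ ψ.symm) (ψ.target ∩ ψ.symm ⁻¹' ψ'.source) := by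
    rw [← contMDiffOn_iff_contDiffOn]
    exact (contMDiffOn_of_mem_maximalAtlas hs'.mem_atlas').comp
      ((contMDiffOn_symm_of_mem_maximalAtlas hs.mem_atlas').mono inter_subset_left)
      inter_subset_right
  exact h1.mono fun y hy => ⟨hy.1.1, ((toBlowUp_mem_sheet_iff hs' θ' _).1 hy.1.2).1⟩

theorem sideChart_mem_maximalAtlas (hs : IsSliceChart (𝓡 (N + 1)) ι φ ψ) (θ : ℤˣ) :
    sideChart h hs θ ∈ IsManifold.maximalAtlas (𝓡 N) ∞ (SideCover h) :=
  IsManifold.subset_maximalAtlas ⟨φ, ψ, hs, θ, rfl⟩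

theorem isSliceChart_polarChart (hs : IsSliceChart (𝓡 (N + 1)) ι φ ψ) (θ : ℤˣ) :
    IsSliceChart (𝓡∂ (N + 1)) (toBlowUp : SideCover h → BlowUp h)
      (BlowUp.polarChart h hs.isDefiningChart θ) (sideChart h hs θ) where
  mem_atlas := BlowUp.polarChart_mem_maximalAtlas _ θ
  mem_atlas' := sideChart_mem_maximalAtlas hs θ
  source_eq := rfl
  apply_eq z hz := by
    refine (BlowUp.polarChart_val hs.isDefiningChart hz).trans ?_
    change reflect θ (φ (ι z.base)) = _
    rw [hs.apply_eq_sliceVec ((toBlowUp_mem_sheet_iff hs θ z).1 hz).1, reflect_sliceVec_zero]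
    rfl
  mem_range_iff p hp := by
    have h0 : (BlowUp.polarChart h hs.isDefiningChart θ).extend (𝓡∂ (N + 1)) p =
      reflect θ (φ p.pt) := BlowUp.polarChart_val hs.isDefiningChart hp
    rw [h0, range_toBlowUp, mem_preimage, hs.isDefiningChart.mem_range_iff _ hp.1,
      reflect_apply_zero, mul_eq_zero]
    refine (or_iff_right ?_).symm
    simp

theorem isSmoothEmbedding_toBlowUp :
    IsSmoothEmbedding (𝓡 N) (𝓡∂ (N + 1)) ∞ (toBlowUp : SideCover h → BlowUp h) := by
  refine ⟨⟨ℝ, inferInstance, inferInstance, fun z => ?_⟩, isEmbedding_toBlowUp⟩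
  obtain ⟨φ, ψ, hs, hz⟩ := h.exists_sliceChart z.base
  obtain ⟨θ, hθ⟩ := exists_mem_sideChart_source hs hz
  have hslice := isSliceChart_polarChart (h := h) hs θ
  refine IsImmersionAtOfComplement.mk_of_charts sliceEquiv (sideChart h hs θ)
    (BlowUp.polarChart h hs.isDefiningChart θ) hθ hθ hslice.mem_atlas' hslice.mem_atlas
    hslice.source_eq.le fun y hy => ?_
  have hy' : y ∈ (sideChart h hs θ).target := by simpa using hy
  refine (hslice.apply_eq _ ((sideChart h hs θ).map_target hy')).trans ?_
  rw [(sideChart h hs θ).right_inv hy']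
  rfl

theorem range_toBlowUp_eq_boundary :
    range (toBlowUp : SideCover h → BlowUp h) = (𝓡∂ (N + 1)).boundary (BlowUp h) := by
  rw [range_toBlowUp]
  ext p
  exact (BlowUp.isBoundaryPoint_iff p).symm

theorem contMDiff_base : ContMDiff (𝓡 N) (𝓡 N) ∞ (base : SideCover h → Z) := by
  intro z
  obtain ⟨φ, ψ, hs, hz⟩ := h.exists_sliceChart z.base
  obtain ⟨θ, hθ⟩ := exists_mem_sideChart_source hs hz
  have h1 : ContMDiffAt (𝓡 N) (𝓡 N) ∞ (sideChart h hs θ) z :=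
    contMDiffAt_of_mem_maximalAtlas (sideChart_mem_maximalAtlas hs θ) hθ
  have h2 : ContMDiffAt (𝓡 N) (𝓡 N) ∞ ψ.symm (sideChart h hs θ z) :=
    contMDiffAt_symm_of_mem_maximalAtlas hs.mem_atlas' ((sideChart h hs θ).map_source hθ)
  refine (h2.comp z h1).congr_of_eventuallyEq ?_
  filter_upwards [(sideChart h hs θ).open_source.mem_nhds hθ] with z' hz'
  exact (ψ.left_inv ((toBlowUp_mem_sheet_iff hs θ z').1 hz').1).symm

theorem isLocalDiffeomorph_base :
    IsLocalDiffeomorph (𝓡 N) (𝓡 N) ∞ (base : SideCover h → Z) := by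
  intro z
  obtain ⟨φ, ψ, hs, hz⟩ := h.exists_sliceChart z.base
  obtain ⟨θ, hθ⟩ := exists_mem_sideChart_source hs hz
  have hbase : ∀ z' ∈ (sideChart h hs θ).source, z'.base ∈ ψ.source :=
    fun z' hz' => ((toBlowUp_mem_sheet_iff hs θ z').1 hz').1
  exact ⟨{ toFun := base
           invFun := fun z' => (sideChart h hs θ).symm (ψ z')
           source := (sideChart h hs θ).source
           target := ψ.source
           map_source' := hbase
           map_target' := fun z' hz' => (sideChart h hs θ).map_target (ψ.map_source hz')
           left_inv' := fun z' hz' => (sideChart h hs θ).left_inv hz'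
           right_inv' := fun z' hz' => ψ.left_inv hz'
           open_source := (sideChart h hs θ).open_source
           open_target := ψ.open_source
           contMDiffOn_toFun := contMDiff_base.contMDiffOn
           contMDiffOn_invFun := (contMDiffOn_symm_of_mem_maximalAtlas
             (sideChart_mem_maximalAtlas hs θ)).comp
               (contMDiffOn_of_mem_maximalAtlas hs.mem_atlas') fun z' hz' => ψ.map_source hz' },
    hθ, fun _ _ => rfl⟩

theorem isCoveringMap_base : IsCoveringMap (base : SideCover h → Z) := by
  intro z
  obtain ⟨φ, ψ, hs, hz⟩ := h.exists_sliceChart z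
  refine IsEvenlyCovered.to_isEvenlyCovered_preimage (I := ℤˣ) ⟨inferInstance, ψ.source, hz,
    ψ.open_source, ψ.open_source.preimage continuous_base,
    { toFun := fun z' => (⟨z'.1.base, z'.2⟩, z'.1.side * h.side φ (ι z'.1.base))
      invFun := fun w => ⟨⟨w.1, w.2 * h.side φ (ι w.1)⟩, w.1.2⟩
      left_inv := fun z' => by
        refine Subtype.ext ?_
        simp only [mul_assoc, Int.units_mul_self, mul_one]
      right_inv := fun w => by
        simp only [mul_assoc, Int.units_mul_self, mul_one]
      continuous_toFun := ?_
      continuous_invFun := ?_ }, fun _ => rfl⟩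
  · refine ((continuous_base.comp continuous_subtype_val).subtype_mk _).prodMk ?_
    rw [continuous_discrete_rng]
    intro θ
    convert (sideChart h hs θ).open_source.preimage (continuous_subtype_val
      (p := (· ∈ base ⁻¹' ψ.source))) using 1
    ext z'
    refine Iff.trans ?_ (toBlowUp_mem_sheet_iff hs θ z'.1).symm
    rw [mem_preimage, mem_singleton_iff, and_iff_right (show z'.1.base ∈ ψ.source from z'.2)]
    refine ⟨fun h1 => ?_, fun h1 => ?_⟩
    · rw [← h1, mul_assoc, Int.units_mul_self, mul_one]
    · rw [h1, mul_assoc, Int.units_mul_self, mul_one]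
  · rw [continuous_prod_of_discrete_right]
    intro θ
    refine Continuous.subtype_mk ?_ _
    have h1 : ContinuousOn (fun z' => (sideChart h hs θ).symm (ψ z')) ψ.source :=
      (sideChart h hs θ).continuousOn_symm.comp ψ.continuousOn fun z' hz' => ψ.map_source hz'
    refine (continuousOn_iff_continuous_domRestrict.1 h1).congr fun z' => ?_
    change ofChart h φ ψ θ (ψ z') = _
    simp only [ofChart, ψ.left_inv z'.2]

theorem isDoubleCover_base : IsDoubleCover N (base : SideCover h → Z) where
  covering := isCoveringMap_base
  localDiffeo := isLocalDiffeomorph_base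
  two_points z := by
    have : (base ⁻¹' {z} : Set (SideCover h)) = {⟨z, 1⟩, ⟨z, -1⟩} := by
      ext ⟨z', s⟩
      rcases Int.units_eq_one_or s with rfl | rfl <;> simp
    rw [this, ncard_pair]
    simp

end SideCover

/-! ### The scattering symplectic form on the blow-up -/

theorem mdifferentiableAt_extend (hφ : φ ∈ IsManifold.maximalAtlas (𝓡 (N + 1)) ∞ X)
    (hq : q ∈ φ.source) : MDifferentiableAt (𝓡 (N + 1)) 𝓘(ℝ, EuclideanSpace ℝ (Fin (N + 1)))
      (φ.extend (𝓡 (N + 1))) q :=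
  (contMDiffAt_of_mem_maximalAtlas hφ hq).mdifferentiableAt (by simp)


theorem mfderiv_extend_restrOpen_addRight (hφ : φ ∈ IsManifold.maximalAtlas (𝓡 (N + 1)) ∞ X)
    (hq : q ∈ φ.source) {s : Set X} (hs : IsOpen s) (w : EuclideanSpace ℝ (Fin (N + 1)))
    (v : TangentSpace (𝓡 (N + 1)) q) :
    mfderiv (𝓡 (N + 1)) 𝓘(ℝ, EuclideanSpace ℝ (Fin (N + 1)))
      (((φ.restrOpen s hs).transHomeomorph (Homeomorph.addRight w)).extend (𝓡 (N + 1))) q v =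
    mfderiv (𝓡 (N + 1)) 𝓘(ℝ, EuclideanSpace ℝ (Fin (N + 1))) (φ.extend (𝓡 (N + 1))) q v := by
  have hfun : (((φ.restrOpen s hs).transHomeomorph (Homeomorph.addRight w)).extend (𝓡 (N + 1)) :
      X → EuclideanSpace ℝ (Fin (N + 1))) = (fun x => x + w) ∘ φ.extend (𝓡 (N + 1)) := rfl
  have hd : DifferentiableAt ℝ (fun x : EuclideanSpace ℝ (Fin (N + 1)) => x + w)
    (φ.extend (𝓡 (N + 1)) q) := by fun_prop
  rw [hfun, mfderiv_comp q hd.mdifferentiableAt (mdifferentiableAt_extend hφ hq),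
    mfderiv_eq_fderiv, fderiv_add_const, fderiv_fun_id]
  rfl

variable [IsManifold (𝓡 (N + 1)) ∞ X] {h : IsHypersurface (N := N) ι}

namespace BlowUp

/-- The pull-back of a `2`-form by the blow-down map. -/
def pullbackForm (h : IsHypersurface (N := N) ι)
    (Ω : ∀ q : X, TangentSpace (𝓡 (N + 1)) q [⋀^Fin 2]→L[ℝ] ℝ) (p : BlowUp h) :
    TangentSpace (𝓡∂ (N + 1)) p [⋀^Fin 2]→L[ℝ] ℝ :=
  (Ω p.pt).compContinuousLinearMap (mfderiv (𝓡∂ (N + 1)) (𝓡 (N + 1)) pt p)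

theorem pullbackForm_apply (Ω : ∀ q : X, TangentSpace (𝓡 (N + 1)) q [⋀^Fin 2]→L[ℝ] ℝ)
    (p : BlowUp h) (v w : TangentSpace (𝓡∂ (N + 1)) p) :
    pullbackForm h Ω p ![v, w] = Ω p.pt ![mfderiv (𝓡∂ (N + 1)) (𝓡 (N + 1)) pt p v,
      mfderiv (𝓡∂ (N + 1)) (𝓡 (N + 1)) pt p w] := by
  rw [pullbackForm, ContinuousAlternatingMap.compContinuousLinearMap_apply]
  congr 1
  ext i : 1
  fin_cases i <;> rfl

theorem mfderiv_polarChart (hφ : IsDefiningChart ι φ) {θ : ℤˣ} {p : BlowUp h}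
    (hp : p ∈ sheet h φ θ) (v : TangentSpace (𝓡∂ (N + 1)) p) :
    mfderiv (𝓡∂ (N + 1)) 𝓘(ℝ, EuclideanSpace ℝ (Fin (N + 1)))
      ((polarChart h hφ θ).extend (𝓡∂ (N + 1))) p v =
    reflect θ (mfderiv (𝓡 (N + 1)) 𝓘(ℝ, EuclideanSpace ℝ (Fin (N + 1)))
      (φ.extend (𝓡 (N + 1))) p.pt (mfderiv (𝓡∂ (N + 1)) (𝓡 (N + 1)) pt p v)) := by
  have hev : ((polarChart h hφ θ).extend (𝓡∂ (N + 1)) : BlowUp h → _) =ᶠ[𝓝 p]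
      reflect θ ∘ (φ.extend (𝓡 (N + 1)) ∘ pt) := by
    filter_upwards [(isOpen_sheet hφ θ).mem_nhds hp] with p' hp' using polarChart_val hφ hp'
  have h1 : MDifferentiableAt (𝓡∂ (N + 1)) (𝓡 (N + 1)) (pt : BlowUp h → X) p :=
    contMDiff_pt.mdifferentiable (by simp) p
  have h2 := mdifferentiableAt_extend hφ.mem_atlas hp.1
  rw [hev.mfderiv_eq, mfderiv_comp p (reflect θ).differentiableAt.mdifferentiableAt
    (h2.comp p h1), mfderiv_comp p h2 h1, mfderiv_eq_fderiv, ContinuousLinearMap.fderiv]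
  rfl

theorem mem_polarChart_extend_target (hφ : IsDefiningChart ι φ) (θ : ℤˣ)
    (x : EuclideanSpace ℝ (Fin (N + 1))) :
    x ∈ ((polarChart h hφ θ).extend (𝓡∂ (N + 1))).target ↔
      0 ≤ x 0 ∧ reflect θ x ∈ φ.target := by
  rw [OpenPartialHomeomorph.extend_target, mem_inter_iff,
    range_modelWithCornersEuclideanHalfSpace, and_comm]
  refine and_congr_right fun hx => ?_
  have hval : ((𝓡∂ (N + 1)).symm x).1 = x := (𝓡∂ (N + 1)).right_inv
    (by rw [range_modelWithCornersEuclideanHalfSpace]; exact hx)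
  rw [mem_preimage, polarChart_target, mem_preimage, polar_eq_reflect, hval]

/-- On the side `θ`, the components of the pulled-back form in the scattering coframe are those of
the given form, reflected: the coframe changes by the overall sign `θ`, which a `2`-form does not
see. -/
theorem isScatteringChart_polarChart {ψ : OpenPartialHomeomorph Z (EuclideanSpace ℝ (Fin N))}
    {Ω : ∀ q : X, TangentSpace (𝓡 (N + 1)) q [⋀^Fin 2]→L[ℝ] ℝ}
    {η : EuclideanSpace ℝ (Fin (N + 1)) → (EuclideanSpace ℝ (Fin (N + 1))) [⋀^Fin 2]→L[ℝ] ℝ}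
    (hc : IsScatteringChart (𝓡 (N + 1)) ι Ω φ ψ η) (θ : ℤˣ) :
    IsScatteringChart (𝓡∂ (N + 1)) (SideCover.toBlowUp : SideCover h → BlowUp h)
      (pullbackForm h Ω) (polarChart h hc.slice.isDefiningChart θ)
      (SideCover.sideChart h hc.slice θ) (fun x => η (reflect θ x)) where
  slice := SideCover.isSliceChart_polarChart hc.slice θ
  smooth := by
    refine hc.smooth.comp (reflect θ).contDiff.contDiffOn fun x hx => ?_
    rw [mem_polarChart_extend_target] at hx
    simpa using hx.2
  apply_eq p hp hpS v w := by
    have hpS' : p.pt ∉ range ι := by rwa [SideCover.range_toBlowUp] at hpS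
    have hval : (polarChart h hc.slice.isDefiningChart θ).extend (𝓡∂ (N + 1)) p =
      reflect θ (φ.extend (𝓡 (N + 1)) p.pt) := polarChart_val hc.slice.isDefiningChart hp
    rw [pullbackForm_apply, hc.apply_eq p.pt hp.1 hpS', mfderiv_polarChart _ hp,
      mfderiv_polarChart _ hp, hval, reflect_reflect, reflect_apply_zero]
    exact (alternating_scatteringCoframe_reflect _ θ _ _ _).symm
  nondegenerate x hx := by
    rw [mem_polarChart_extend_target] at hx
    exact hc.nondegenerate _ (by simpa using hx.2)

theorem isScatteringSymplectic_pullbackForm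
    {Ω : ∀ q : X, TangentSpace (𝓡 (N + 1)) q [⋀^Fin 2]→L[ℝ] ℝ}
    (hΩ : IsScatteringSymplectic (𝓡 (N + 1)) ι Ω) :
    IsScatteringSymplectic (𝓡∂ (N + 1)) (SideCover.toBlowUp : SideCover h → BlowUp h)
      (pullbackForm h Ω) where
  regular p hp := by
    have hpS : p.pt ∉ range ι := by rwa [SideCover.range_toBlowUp] at hp
    obtain ⟨φ, hφ, hpφ, σ, hσ, hΩσ, hcl⟩ := hΩ.regular p.pt hpS
    obtain ⟨s, hs, w, hd, hps, -, hpos⟩ :=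
      exists_isDefiningChart_of_notMem h.isClosed_range hφ hpφ hpS
    have htgt : ∀ x, x ∈ ((polarChart h hd 1).extend (𝓡∂ (N + 1))).target ↔
        x - w ∈ (φ.restrOpen s hs).target := fun x => by
      rw [mem_polarChart_extend_target, reflect_one]
      have hiff : x ∈ ((φ.restrOpen s hs).transHomeomorph (Homeomorph.addRight w)).target ↔
          x - w ∈ (φ.restrOpen s hs).target := by
        rw [sub_eq_add_neg]; rfl
      rw [hiff, and_iff_right_of_imp]
      intro hx
      have h1 := hpos _ hx.2
      change 0 < (φ (φ.symm (x - w)) + w) 0 at h1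
      rw [φ.right_inv hx.1, sub_add_cancel] at h1
      exact h1.le
    -- The chart takes values in `x > 0`, so its image is open in the whole space, and derivatives
    -- within it are ordinary ones.
    have hopen : IsOpen ((polarChart h hd 1).extend (𝓡∂ (N + 1))).target := by
      have : ((polarChart h hd 1).extend (𝓡∂ (N + 1))).target =
          (fun x => x - w) ⁻¹' (φ.restrOpen s hs).target := Set.ext htgt
      rw [this]
      exact (φ.restrOpen s hs).open_target.preimage (by fun_prop)
    have htgt' : ∀ x ∈ ((polarChart h hd 1).extend (𝓡∂ (N + 1))).target,
        x - w ∈ (φ.extend (𝓡 (N + 1))).target := fun x hx => by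
      simpa using ((htgt x).1 hx).1
    have hopen' : IsOpen (φ.extend (𝓡 (N + 1))).target := φ.isOpen_extend_target
    refine ⟨polarChart h hd 1, polarChart_mem_maximalAtlas hd 1,
      ⟨⟨hpφ, hps⟩, fun _ => by simpa using hpos _ hps, fun hS => absurd hS hpS⟩,
      fun x => σ (x - w), hσ.comp (by fun_prop) htgt', fun p' hp' v v' => ?_, fun x hx => ⟨?_, ?_⟩⟩
    · have hval : (polarChart h hd 1).extend (𝓡∂ (N + 1)) p' =
          φ.extend (𝓡 (N + 1)) p'.pt + w := by
        refine (polarChart_val hd hp').trans ?_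
        rw [reflect_one]
        rfl
      have hp'φ : p'.pt ∈ φ.source := hp'.1.1
      have hD := fun v => (mfderiv_polarChart hd hp' v).trans ((reflect_one _).trans
        (mfderiv_extend_restrOpen_addRight hφ hp'φ hs w _))
      rw [pullbackForm_apply, hΩσ _ hp'φ, hD, hD, hval]
      beta_reduce
      rw [add_sub_cancel_right]
    · have h0 := (hcl _ (htgt' x hx)).1
      rw [extDerivWithin, fderivWithin_of_isOpen hopen' (htgt' x hx)] at h0
      rw [extDerivWithin, fderivWithin_of_isOpen hopen hx, fderiv_comp_sub]
      exact h0
    · exact (hcl _ (htgt' x hx)).2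
  singular z := by
    obtain ⟨φ, ψ, η, hc, hz⟩ := hΩ.singular z.base
    obtain ⟨θ, hθ⟩ := SideCover.exists_mem_sideChart_source hc.slice hz
    exact ⟨_, _, _, isScatteringChart_polarChart hc θ, hθ⟩

theorem inducesContact_pullbackForm
    {Ω : ∀ q : X, TangentSpace (𝓡 (N + 1)) q [⋀^Fin 2]→L[ℝ] ℝ}
    {α : ∀ z : Z, TangentSpace (𝓡 N) z →L[ℝ] ℝ} (hα : InducesContact (𝓡 (N + 1)) ι Ω α) :
    InducesContact (𝓡∂ (N + 1)) (SideCover.toBlowUp : SideCover h → BlowUp h)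
      (pullbackForm h Ω) (pullbackOneForm N SideCover.base α) := by
  intro z
  obtain ⟨φ, ψ, η, hc, hz, c, hc0, hcα⟩ := hα z.base
  obtain ⟨θ, hθ⟩ := SideCover.exists_mem_sideChart_source hc.slice hz
  refine ⟨_, _, _, isScatteringChart_polarChart hc θ, hθ, c, hc0, fun v => ?_⟩
  have h1 : MDifferentiableAt (𝓡 N) (𝓡 N) (SideCover.base : SideCover h → Z) z :=
    SideCover.contMDiff_base.mdifferentiable (by simp) z
  have h2 : MDifferentiableAt (𝓡 N) 𝓘(ℝ, EuclideanSpace ℝ (Fin N)) ψ z.base :=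
    (contMDiffAt_of_mem_maximalAtlas hc.slice.mem_atlas' hz).mdifferentiableAt (by simp)
  have hfun : (SideCover.sideChart h hc.slice θ : SideCover h → EuclideanSpace ℝ (Fin N)) =
      ψ ∘ SideCover.base := rfl
  rw [hfun, mfderiv_comp z h2 h1, reflect_sliceVec_zero]
  exact hcα _

end BlowUp

end

end Scattering

theorem proposition3p3 {N : ℕ}
    -- the non-orientable manifold, of dimension `N + 1`
    {X : Type u} [TopologicalSpace X] [T2Space X] [SecondCountableTopology X]
    [ChartedSpace (EuclideanSpace ℝ (Fin (N + 1))) X] [IsManifold (𝓡 (N + 1)) ∞ X]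
    (hX : ¬ Scattering.IsOrientable (N + 1) X)
    -- the closed hypersurface
    {Z : Type v} [TopologicalSpace Z] [ChartedSpace (EuclideanSpace ℝ (Fin N)) Z]
    [IsManifold (𝓡 N) ∞ Z] (ι : Z → X) (hι : IsSmoothEmbedding (𝓡 N) (𝓡 (N + 1)) ∞ ι)
    (hZ : IsClosed (range ι))
    -- the scattering symplectic structure, and the contact manifold which is its singular locus
    (Ω : ∀ q : X, TangentSpace (𝓡 (N + 1)) q [⋀^Fin 2]→L[ℝ] ℝ)
    (hsymp : Scattering.IsScatteringSymplectic (𝓡 (N + 1)) ι Ω)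
    (α : ∀ z : Z, TangentSpace (𝓡 N) z →L[ℝ] ℝ) (hα : Scattering.IsContactForm N α)
    (hcoor : Scattering.InducesContact (𝓡 (N + 1)) ι Ω α) :
    -- the double cover
    ∃ (Z' : Type v) (_ : TopologicalSpace Z') (_ : T2Space Z') (_ : SecondCountableTopology Z')
      (_ : ChartedSpace (EuclideanSpace ℝ (Fin N)) Z') (_ : IsManifold (𝓡 N) ∞ Z') (p : Z' → Z),
      Scattering.IsDoubleCover N p ∧
      -- the symplectic manifold with scattering boundary
      ∃ (X' : Type (max u v)) (_ : TopologicalSpace X') (_ : T2Space X')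
        (_ : SecondCountableTopology X') (_ : ChartedSpace (EuclideanHalfSpace (N + 1)) X')
        (_ : IsManifold (𝓡∂ (N + 1)) ∞ X') (ι' : Z' → X')
        (Ω' : ∀ q : X', TangentSpace (𝓡∂ (N + 1)) q [⋀^Fin 2]→L[ℝ] ℝ),
        Scattering.HasScatteringBoundary N ι' Ω'
          (Scattering.pullbackOneForm N p α) ∧
        -- it is the real oriented blow-up along the hypersurface
        ∃ b : X' → X, Scattering.IsRealOrientedBlowUp N ι b ∧ b ∘ ι' = ι ∘ p ∧
          b ⁻¹' range ι = range ι' ∧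
          ∀ q ∉ range ι', ∀ v w : TangentSpace (𝓡∂ (N + 1)) q,
            Ω' q ![v, w] = Ω (b q) ![mfderiv (𝓡∂ (N + 1)) (𝓡 (N + 1)) b q v,
              mfderiv (𝓡∂ (N + 1)) (𝓡 (N + 1)) b q w] := by
  have h : Scattering.IsHypersurface (N := N) ι :=
    ⟨hι.isEmbedding, hZ, fun z =>
      let ⟨φ, ψ, _, hc, hz⟩ := hsymp.singular z
      ⟨φ, ψ, hc.slice, hz⟩⟩
  exact ⟨Scattering.SideCover h, inferInstance, inferInstance, inferInstance, inferInstance,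
    inferInstance, Scattering.SideCover.base, Scattering.SideCover.isDoubleCover_base,
    Scattering.BlowUp h, inferInstance, inferInstance, inferInstance, inferInstance, inferInstance,
    Scattering.SideCover.toBlowUp, Scattering.BlowUp.pullbackForm h Ω,
    { embedding := Scattering.SideCover.isSmoothEmbedding_toBlowUp
      range_eq := Scattering.SideCover.range_toBlowUp_eq_boundary
      symplectic := Scattering.BlowUp.isScatteringSymplectic_pullbackForm hsymp
      contact := hα.pullback Scattering.SideCover.isLocalDiffeomorph_base
      induces := Scattering.BlowUp.inducesContact_pullbackForm hcoor },
    Scattering.BlowUp.pt, Scattering.BlowUp.isRealOrientedBlowUp, rfl,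
    Scattering.SideCover.range_toBlowUp.symm,
    fun q _ v w => Scattering.BlowUp.pullbackForm_apply Ω q v w⟩
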